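/- Let $T$ be a theory in ($[0,1]$-valued) continuous logic and let $\mathcal U$ be a monster model of $T$, i.e. a $\kappa$-saturated and strongly $\kappa$-homogeneous model for some uncountable $\kappa$. Formulas are built from atomic formulas with $\sup$, $\inf$ and all continuous connectives $[0,1]^k\to[0,1]$; $x,y$ denote finite tuples of variables and elements $a_i,b_i,b$ are tuples from $\mathcal U$ of the appropriate length. The properties of $T$ below are evaluated in $\mathcal U$. - $T$ has *wSOP* (weak strict order property) if there are a formula $\phi(x,y)$ and $\epsilon>0$ such that for every natural number $n\ge 1$ there are a formula $\psi_n(x,\bar y)=c(\phi(x,y_1),\dots,\phi(x,y_r))$, where $\bar y=(y_1,\dots,y_r)$ and $c:[0,1]^r\to[0,1]$ is continuous, an indiscernible sequence $(a_i)_{i<\omega}$ of $\bar y$-tuples and a sequence $(b_i)_{i<\omega}$ of $x$-tuples such that: for all $b\in\mathcal U$ the sequence $(\psi_n(b,a_i))_{i<\omega}$ converges; $\psi_n(b,a_i)\mathbin{\dot-}\psi_n(b,a_{i+1})\le\epsilon/n$ for all $b\in\mathcal U$ and all $i$; and $\psi_n(b_j,a_i)+\epsilon<\psi_n(b_i,a_j)$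 for all $i<j$. *NwSOP* is the negation of wSOP. - A formula $\phi(x,y)$ has *NSCP* if there are an indiscernible sequence $(a_i)_{i<\omega}$, a sequence $(b_i)_{i<\omega}$ and $\epsilon>0$ such that for all $b\in\mathcal U$ the sequence $(\phi(b,a_i))_{i<\omega}$ converges, and $\phi(b_j,a_i)+\epsilon<\phi(b_i,a_j)$ for all $i<j$. $T$ is *SCP* (weak sequential completeness property) if no formula has NSCP. Then the following are equivalent: (i) $T$ is NwSOP; (ii) $T$ is SCP; (iii) for every formula $\phi(x,y)$ and every indiscernible sequence $(a_i)_{i<\omega}$, if the functions $\phi(x,a_i)$ converge pointwise on the compact space $S_\phi(\mathcal U)$ of $\phi$-types over $\mathcal U$, then their limit is continuous on $S_\phi(\mathcal U)$. -/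

import Mathlib

universe u v w

open Filter Topology

namespace ContLogic


/-- A signature of (bounded, single-sorted) continuous logic: function symbols and `[0,1]`-valued
predicate symbols, each with a modulus of uniform continuity. -/
structure ContLanguage extends FirstOrder.Language.{u, v} where
  funModulus : ∀ {n : ℕ}, Functions n → ℝ → ℝ
  funModulus_pos : ∀ {n : ℕ} (f : Functions n) (ε : ℝ), 0 < ε → 0 < funModulus f ε
  relModulus : ∀ {n : ℕ}, Relations n → ℝ → ℝ
  relModulus_pos : ∀ {n : ℕ} (R : Relations n) (ε : ℝ), 0 < ε → 0 < relModulus R ε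

/-- A metric structure: a nonempty complete metric space of diameter at most `1` with
interpretations of the symbols that respect the moduli of uniform continuity
(finite powers carry the maximum metric). -/
class ContStructure (L : ContLanguage.{u, v}) (M : Type w) [MetricSpace M] where
  nonempty : Nonempty M
  complete : CompleteSpace M
  dist_le_one : ∀ x y : M, dist x y ≤ 1
  funMap : ∀ {n : ℕ}, L.Functions n → (Fin n → M) → M
  relMap : ∀ {n : ℕ}, L.Relations n → (Fin n → M) → unitInterval
  funMap_unif : ∀ {n : ℕ} (f : L.Functions n) (ε : ℝ), 0 < ε → ∀ x y : Fin n → M,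
    dist x y < L.funModulus f ε → dist (funMap f x) (funMap f y) ≤ ε
  relMap_unif : ∀ {n : ℕ} (R : L.Relations n) (ε : ℝ), 0 < ε → ∀ x y : Fin n → M,
    dist x y < L.relModulus R ε → dist (relMap R x) (relMap R y) ≤ ε

/-- Formulas of continuous logic with free variables in `α` and `n` further (de Bruijn style)
variables. The connectives are all continuous functions `[0,1]^k → [0,1]`. -/
inductive BFormula (L : ContLanguage.{u, v}) (α : Type w) : ℕ → Type (max u v w)
  | dist {n : ℕ} (s t : L.toLanguage.Term (α ⊕ Fin n)) : BFormula L α n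
  | rel {n k : ℕ} (R : L.Relations k) (ts : Fin k → L.toLanguage.Term (α ⊕ Fin n)) :
      BFormula L α n
  | conn {n k : ℕ} (c : C(Fin k → unitInterval, unitInterval)) (φ : Fin k → BFormula L α n) :
      BFormula L α n
  | sup {n : ℕ} (φ : BFormula L α (n + 1)) : BFormula L α n
  | inf {n : ℕ} (φ : BFormula L α (n + 1)) : BFormula L α n

/-- Formulas with free variables in `α`. -/
abbrev Formula (L : ContLanguage.{u, v}) (α : Type w) := BFormula L α 0

/-- Renaming of free variables. -/
def BFormula.relabel {L : ContLanguage.{u, v}} {α β : Type w} (g : α → β) :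
    {n : ℕ} → BFormula L α n → BFormula L β n
  | _, .dist s t => .dist (s.relabel (Sum.map g id)) (t.relabel (Sum.map g id))
  | _, .rel R ts => .rel R (fun i => (ts i).relabel (Sum.map g id))
  | _, .conn c φ => .conn c (fun i => (φ i).relabel g)
  | _, .sup φ => .sup (φ.relabel g)
  | _, .inf φ => .inf (φ.relabel g)

section Semantics

variable {L : ContLanguage.{u, v}} {M : Type w} [MetricSpace M] [ContStructure L M]

/-- The value of a term under an assignment. -/
def termVal (L : ContLanguage.{u, v}) [ContStructure L M] {α : Type*} (e : α → M) :
    L.toLanguage.Term α → M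
  | .var a => e a
  | .func f ts => ContStructure.funMap (L := L) f (fun i => termVal L e (ts i))

/-- The distance of a metric structure as an element of `[0,1]`. -/
def unitDist (L : ContLanguage.{u, v}) [ContStructure L M] (x y : M) : unitInterval :=
  ⟨dist x y, dist_nonneg, ContStructure.dist_le_one L x y⟩

/-- The value in `[0,1]` of a formula under an assignment. -/
noncomputable def BFormula.realize {α : Type*} (e : α → M) :
    {n : ℕ} → BFormula L α n → (Fin n → M) → unitInterval
  | _, .dist s t, x => unitDist L (termVal L (Sum.elim e x) s) (termVal L (Sum.elim e x) t)
  | _, .rel R ts, x => ContStructure.relMap (L := L) R (fun i => termVal L (Sum.elim e x) (ts i))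
  | _, .conn c φ, x => c (fun i => (φ i).realize e x)
  | _, .sup φ, x => ⨆ y : M, φ.realize e (Fin.snoc x y)
  | _, .inf φ, x => ⨅ y : M, φ.realize e (Fin.snoc x y)

/-- The value of a formula at an assignment of its free variables. -/
noncomputable def Formula.val {α : Type*} (φ : Formula L α) (e : α → M) : unitInterval :=
  BFormula.realize e φ Fin.elim0

/-- The real number `φ(b, a)`, for a formula `φ(x, y)` in two tuples of variables. -/
noncomputable def Formula.val₂ {ι κ : Type} (φ : Formula L (ι ⊕ κ)) (b : ι → M) (a : κ → M) : ℝ :=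
  (Formula.val φ (Sum.elim b a) : unitInterval)

end Semantics

/-- A theory is a set of sentences `σ`, read as the closed conditions `σ = 0`. -/
abbrev Theory (L : ContLanguage.{u, v}) := Set (Formula L Empty)

section Monster

variable (L : ContLanguage.{u, v}) (M : Type w) [MetricSpace M] [ContStructure L M]

/-- `M` is a model of `T`. -/
def IsModel {L : ContLanguage.{u, v}} (T : Theory L) (M : Type w) [MetricSpace M]
    [ContStructure L M] : Prop :=
  ∀ σ ∈ T, Formula.val σ (Empty.elim : Empty → M) = 0

/-- `κ`-saturation: a set of conditions `φ(x) = 0` with parameters from a set `A` of cardinality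
`< κ`, in a finite tuple `x`, is satisfied in `M` as soon as all its finite subsets are. -/
def IsSaturated (κ : Cardinal.{w}) : Prop :=
  ∀ A : Set M, Cardinal.mk A < κ → ∀ (n : ℕ) (Γ : Set (Formula L (A ⊕ Fin n))),
    (∀ Γ₀ : Finset (Formula L (A ⊕ Fin n)), (Γ₀ : Set (Formula L (A ⊕ Fin n))) ⊆ Γ →
      ∃ b : Fin n → M, ∀ φ ∈ Γ₀, Formula.val φ (Sum.elim (fun a : A => (a : M)) b) = 0) →
    ∃ b : Fin n → M, ∀ φ ∈ Γ, Formula.val φ (Sum.elim (fun a : A => (a : M)) b) = 0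

/-- An isometric bijection that preserves all function and predicate symbols. -/
def IsAutomorphism (σ : M ≃ᵢ M) : Prop :=
  (∀ (n : ℕ) (f : L.Functions n) (x : Fin n → M),
    σ (ContStructure.funMap (L := L) f x) = ContStructure.funMap (L := L) f (fun i => σ (x i))) ∧
  (∀ (n : ℕ) (R : L.Relations n) (x : Fin n → M),
    ContStructure.relMap (L := L) R (fun i => σ (x i)) = ContStructure.relMap (L := L) R x)

/-- Strong `κ`-homogeneity: every elementary map defined on a set of cardinality `< κ` extends to
an automorphism. -/
def IsStronglyHomogeneous (κ : Cardinal.{w}) : Prop :=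
  ∀ A : Set M, Cardinal.mk A < κ → ∀ f : A → M,
    (∀ φ : Formula L A, Formula.val φ f = Formula.val φ (fun a : A => (a : M))) →
    ∃ σ : M ≃ᵢ M, IsAutomorphism L M σ ∧ ∀ a : A, σ a = f a

/-- `M` is a monster model of `T`: a `κ`-saturated and strongly `κ`-homogeneous model, for some
uncountable `κ`. -/
def IsMonsterModel {L : ContLanguage.{u, v}} (T : Theory L) (M : Type w) [MetricSpace M]
    [ContStructure L M] : Prop :=
  IsModel T M ∧ ∃ κ : Cardinal.{w}, Cardinal.aleph0 < κ ∧
    IsSaturated L M κ ∧ IsStronglyHomogeneous L M κ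

/-- A sequence of tuples is indiscernible (over `∅`) if all increasing finite subsequences of the
same length satisfy the same formulas with the same values. -/
def IsIndiscernible {ι : Type} (a : ℕ → ι → M) : Prop :=
  ∀ (n : ℕ) (χ : Formula L (Fin n × ι)) (s t : Fin n → ℕ), StrictMono s → StrictMono t →
    Formula.val χ (fun p => a (s p.1) p.2) = Formula.val χ (fun p => a (t p.1) p.2)

end Monster

/-- The combination `c(φ(x, y₁), …, φ(x, y_r))` of instances of `φ(x, y)` by a connective `c`:
a formula `ψ(x; y₁, …, y_r)`. Some of the `y_j` can be kept fixed along a sequence of tuples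
`(y₁, …, y_r)`, where they play the role of parameters. -/
def combination {L : ContLanguage.{u, v}} {k m r : ℕ} (φ : Formula L (Fin k ⊕ Fin m))
    (c : C(Fin r → unitInterval, unitInterval)) : Formula L (Fin k ⊕ (Fin r × Fin m)) :=
  .conn c (fun j => φ.relabel (Sum.map id (fun i => (j, i))))

section Properties

variable (L : ContLanguage.{u, v}) (U : Type w) [MetricSpace U] [ContStructure L U]

/-- The weak strict order property, evaluated in the monster model `U`. -/
def HasWSOP : Prop :=
  ∃ (k m : ℕ) (φ : Formula L (Fin k ⊕ Fin m)) (ε : ℝ), 0 < ε ∧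
    ∀ n : ℕ, 1 ≤ n →
      ∃ (r : ℕ) (c : C(Fin r → unitInterval, unitInterval))
        (a : ℕ → (Fin r × Fin m) → U) (b : ℕ → Fin k → U),
        IsIndiscernible L U a ∧
        (∀ d : Fin k → U, ∃ l : ℝ,
          Tendsto (fun i => Formula.val₂ (combination φ c) d (a i)) atTop (𝓝 l)) ∧
        (∀ (i : ℕ) (d : Fin k → U),
          Formula.val₂ (combination φ c) d (a i) - Formula.val₂ (combination φ c) d (a (i + 1))
            ≤ ε / n) ∧
        (∀ i j : ℕ, i < j →
          Formula.val₂ (combination φ c) (b j) (a i) + ε <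
            Formula.val₂ (combination φ c) (b i) (a j))

/-- NwSOP: the negation of wSOP. -/
def NwSOP : Prop := ¬ HasWSOP L U

/-- The formula `φ(x, y)` has NSCP, evaluated in the monster model `U`. -/
def FormulaHasNSCP {L : ContLanguage.{u, v}} (U : Type w) [MetricSpace U] [ContStructure L U]
    {k m : ℕ} (φ : Formula L (Fin k ⊕ Fin m)) : Prop :=
  ∃ (a : ℕ → Fin m → U) (b : ℕ → Fin k → U) (ε : ℝ), 0 < ε ∧
    IsIndiscernible L U a ∧
    (∀ d : Fin k → U, ∃ l : ℝ, Tendsto (fun i => Formula.val₂ φ d (a i)) atTop (𝓝 l)) ∧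
    (∀ i j : ℕ, i < j → Formula.val₂ φ (b j) (a i) + ε < Formula.val₂ φ (b i) (a j))

/-- SCP: no formula has NSCP. -/
def SCP : Prop := ∀ (k m : ℕ) (φ : Formula L (Fin k ⊕ Fin m)), ¬ FormulaHasNSCP U φ

/-- The compact space `S_φ(U)` of `φ`-types over `U`, a type `p` being identified with the function
`a ↦ φ(x, a)ᵖ`. A function is a `φ`-type iff it is finitely approximable by elements of `U`, i.e.
iff it lies in the closure of the realized types for pointwise convergence. -/
def phiTypes {L : ContLanguage.{u, v}} (U : Type w) [MetricSpace U] [ContStructure L U]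
    {k m : ℕ} (φ : Formula L (Fin k ⊕ Fin m)) : Set ((Fin m → U) → unitInterval) :=
  closure (Set.range fun (b : Fin k → U) (a : Fin m → U) => Formula.val φ (Sum.elim b a))

/-- For every formula `φ(x, y)` and indiscernible sequence `(a_i)`, if the functions `φ(x, a_i)`
converge pointwise on `S_φ(U)`, then their limit is continuous. -/
def IndiscernibleLimitsContinuous : Prop :=
  ∀ (k m : ℕ) (φ : Formula L (Fin k ⊕ Fin m)) (a : ℕ → Fin m → U), IsIndiscernible L U a →
    ∀ f : phiTypes U φ → ℝ,
      (∀ p : phiTypes U φ, Tendsto (fun i => ((p.1 (a i) : unitInterval) : ℝ)) atTop (𝓝 (f p))) →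
      Continuous f

end Properties

end ContLogic

universe w'

namespace ContLogic

/-! The substance is that NSCP implies wSOP. Given an indiscernible sequence `a` along which `φ`
converges, let `V` be the set of sequences `(φ(d, a_i))_i`. Saturation makes `V` compact,
indiscernibility closes it under subsequences, and its members converge. Hence the number of
disjoint drops of a fixed size in a member of `V` is bounded (`exists_card_drops_le`), while the
NSCP pattern yields members that stay below some `r` for any prescribed time and above some `s > r`
ever after (`exists_low_high`).

These give the jump that wSOP asks for, but values may also fall between consecutive tuples. To
control this, as many drops as possible are prescribed at the start of a sequence, provided that
long low and then long high runs can still follow (`exists_maximal_stage`). By maximality, between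
the prescribed drops and a long high run, a value above one of `J` nested bands cannot be followed
by a long run below that band. A connective that tests the initial drops and the high tail, and
applies the average of `J` ramps on the bands to the maximum of a block in between, then falls by at
most `2 / J`: a fall that crosses no whole band involves at most two ramps (`exists_connective`).
Initial block and tail become fixed parameters, the tail being a block placed at infinity
(`exists_orderIndiscernible_withTop`); `FormulaHasNSCP.hasWSOP` assembles this.

Conversely, wSOP for `n = 1` contains NSCP for a combination of instances of `φ`. As to continuity,
an NSCP pattern makes the limit function jump by `ε` at an accumulation point of the types of the
`b_j`. A discontinuity at `p`, in turn, provides tuples agreeing with `p` on ever longer initial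
segments but with a distant limit, and these form an NSCP pattern for `φ` or `1 - φ`. -/

theorem exists_dist_lt_of_mem_closure {S X : Type*} [PseudoMetricSpace X] {R : Set (S → X)}
    {w : S → X} (h : w ∈ closure R) (F : Finset S) {ε : ℝ} (hε : 0 < ε) :
    ∃ x ∈ R, ∀ s ∈ F, dist (x s) (w s) < ε := by
  have hN : (⋂ s ∈ F, {x : S → X | dist (x s) (w s) < ε}) ∈ 𝓝 w := by
    refine (Filter.biInter_finset_mem F).2 fun s _ => ?_
    exact (continuous_apply (A := fun _ : S => X) s).continuousAt.preimage_mem_nhds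
      (t := Metric.ball (w s) ε) (Metric.ball_mem_nhds _ hε)
  obtain ⟨x, hx, hxR⟩ := mem_closure_iff_nhds.1 h _ hN
  exact ⟨x, hxR, fun s hs => by simpa using Set.mem_iInter₂.1 hx s hs⟩

/-! ### Substitution of variables, quantification over tuples, and approximate conditions -/

section Substitution

variable {L : ContLanguage.{u, v}} {M : Type w} [MetricSpace M] [ContStructure L M]

theorem termVal_relabel {α β : Type*} (e : β → M) (g : α → β) (t : L.toLanguage.Term α) :
    termVal L e (t.relabel g) = termVal L (e ∘ g) t := by
  induction t with
  | var a => rfl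
  | func f ts ih =>
    simp only [FirstOrder.Language.Term.relabel, termVal]
    exact congrArg _ (funext fun i => ih i)

theorem realize_relabel {α β : Type w'} (e : β → M) (g : α → β) {n : ℕ} (φ : BFormula L α n)
    (x : Fin n → M) : (φ.relabel g).realize e x = φ.realize (e ∘ g) x := by
  have key : ∀ {n : ℕ} (x : Fin n → M),
      (Sum.elim e x ∘ Sum.map g id : α ⊕ Fin n → M) = Sum.elim (e ∘ g) x := by
    intro n x
    rw [Sum.elim_comp_map, Function.comp_id]
  induction φ with
  | dist s t => simp only [BFormula.relabel, BFormula.realize, termVal_relabel, key]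
  | rel R ts => simp only [BFormula.relabel, BFormula.realize, termVal_relabel, key]
  | conn c φ ih => simp only [BFormula.relabel, BFormula.realize, ih]
  | sup φ ih => simp only [BFormula.relabel, BFormula.realize, ih]
  | inf φ ih => simp only [BFormula.relabel, BFormula.realize, ih]

/-- The map on variables underlying `BFormula.subst`. -/
def substVar {α β : Type*} {k : ℕ} (g : α → β ⊕ Fin k) (n : ℕ) : α ⊕ Fin n → β ⊕ Fin (k + n) :=
  Sum.elim (fun a => (g a).map id (Fin.castAdd n)) (fun j => Sum.inr (Fin.natAdd k j))

/-- Renaming of free variables by free variables or by `k` new bound variables. -/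
def BFormula.subst {α β : Type*} {k : ℕ} (g : α → β ⊕ Fin k) :
    {n : ℕ} → BFormula L α n → BFormula L β (k + n)
  | n, .dist s t => .dist (s.relabel (substVar g n)) (t.relabel (substVar g n))
  | n, .rel R ts => .rel R (fun i => (ts i).relabel (substVar g n))
  | _, .conn c φ => .conn c (fun i => (φ i).subst g)
  | _, .sup φ => .sup (φ.subst g)
  | _, .inf φ => .inf (φ.subst g)

theorem elim_append_comp_substVar {α β X : Type*} {k n : ℕ} (g : α → β ⊕ Fin k) (e : β → X)
    (x : Fin k → X) (y : Fin n → X) :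
    Sum.elim e (Fin.append x y) ∘ substVar g n = Sum.elim (Sum.elim e x ∘ g) y := by
  funext a
  rcases a with a | j
  · simp only [substVar, Function.comp_apply, Sum.elim_inl]
    cases g a <;> simp
  · simp [substVar]

theorem realize_subst {α β : Type*} {k : ℕ} (g : α → β ⊕ Fin k) (e : β → M) (x : Fin k → M)
    {n : ℕ} (φ : BFormula L α n) (y : Fin n → M) :
    (φ.subst g).realize e (Fin.append x y) = φ.realize (Sum.elim e x ∘ g) y := by
  induction φ with
  | dist s t =>
    simp only [BFormula.subst, BFormula.realize, termVal_relabel, elim_append_comp_substVar]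
  | rel R ts =>
    simp only [BFormula.subst, BFormula.realize, termVal_relabel, elim_append_comp_substVar]
  | conn c φ ih => simp only [BFormula.subst, BFormula.realize, ih]
  | sup φ ih =>
    simp only [BFormula.subst, BFormula.realize]
    exact iSup_congr fun z => by rw [← ih, Fin.append_snoc]
  | inf φ ih =>
    simp only [BFormula.subst, BFormula.realize]
    exact iInf_congr fun z => by rw [← ih, Fin.append_snoc]

/-- Renaming of the free variables of a formula, across universes. -/
def Formula.rename {α β : Type*} (g : α → β) (φ : Formula L α) : Formula L β :=
  BFormula.subst (k := 0) (fun a => Sum.inl (g a)) φ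

theorem val_rename {α β : Type*} (g : α → β) (φ : Formula L α) (e : β → M) :
    (φ.rename g).val e = φ.val (e ∘ g) := by
  have h := realize_subst (fun a => (Sum.inl (g a) : β ⊕ Fin 0)) e Fin.elim0 φ Fin.elim0
  have h0 : (Fin.append Fin.elim0 Fin.elim0 : Fin (0 + 0) → M) = Fin.elim0 :=
    funext fun i => i.elim0
  rw [h0] at h
  exact h

/-- Quantification of all the bound variables by `inf`. -/
def BFormula.infs {α : Type*} : {n : ℕ} → BFormula L α n → Formula L α
  | 0, φ => φ
  | _ + 1, φ => BFormula.infs (.inf φ)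

/-- The infimum need not be attained, so only strict upper bounds have witnesses. -/
theorem val_infs_lt_iff {α : Type*} (e : α → M) (r : unitInterval) {n : ℕ}
    (φ : BFormula L α n) : φ.infs.val e < r ↔ ∃ x : Fin n → M, φ.realize e x < r := by
  induction n with
  | zero =>
    exact ⟨fun h => ⟨Fin.elim0, h⟩, fun ⟨x, h⟩ => by rwa [Subsingleton.elim x Fin.elim0] at h⟩
  | succ n ih =>
    simp only [BFormula.infs, ih, BFormula.realize, iInf_lt_iff]
    constructor
    · rintro ⟨x, y, h⟩
      exact ⟨_, h⟩
    · rintro ⟨x, h⟩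
      exact ⟨Fin.init x, x (Fin.last n), by rwa [Fin.snoc_init_self]⟩

/-- The formula `inf_x φ(x, y)` for a tuple `x` of variables. -/
def Formula.infTuple {α : Type*} {k : ℕ} (φ : Formula L (Fin k ⊕ α)) : Formula L α :=
  BFormula.infs (BFormula.subst (k := k) Sum.swap φ)

theorem val_infTuple_lt_iff {α : Type*} {k : ℕ} (φ : Formula L (Fin k ⊕ α)) (e : α → M)
    (r : unitInterval) : φ.infTuple.val e < r ↔ ∃ d : Fin k → M, φ.val (Sum.elim d e) < r := by
  have hs : ∀ d : Fin k → M, Sum.elim e d ∘ Sum.swap = Sum.elim d e := by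
    intro d
    funext z
    cases z <;> rfl
  have key : ∀ d : Fin k → M, (BFormula.subst (k := k) Sum.swap φ).realize e d =
      φ.val (Sum.elim d e) := by
    intro d
    have h := realize_subst (L := L) (Sum.swap (α := Fin k) (β := α)) e d φ Fin.elim0
    rw [hs] at h
    rw [Formula.val, ← h]
    congr 1
    rw [Fin.append_right_nil _ _ rfl]
    rfl
  unfold Formula.infTuple
  rw [val_infs_lt_iff]
  exact exists_congr fun d => by
    constructor
    · intro h; rw [← key]; exact h
    · intro h; rw [← key] at h; exact h

/-- The formula `max_{q ∈ F} |φ_q - w_q|`. -/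
noncomputable def deviation {Q α : Type*} (φ : Q → Formula L α) (w : Q → unitInterval)
    (F : Finset Q) : Formula L α :=
  .conn (k := F.card)
    ⟨fun t => Set.projIcc (0 : ℝ) 1 zero_le_one
      (dist t (fun i => w (F.equivFin.symm i))), by fun_prop⟩
    (fun i => φ (F.equivFin.symm i))

theorem val_deviation_lt_iff {Q α : Type*} (φ : Q → Formula L α) (w : Q → unitInterval)
    (F : Finset Q) (e : α → M) {ε : unitInterval} (hε : 0 < ε) :
    (deviation φ w F).val e < ε ↔ ∀ q ∈ F, dist ((φ q).val e) (w q) < ε := by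
  have h1 : (deviation φ w F).val e = Set.projIcc (0 : ℝ) 1 zero_le_one
      (dist (fun i => (φ (F.equivFin.symm i)).val e) (fun i => w (F.equivFin.symm i))) := rfl
  rw [h1]
  have hε' : (0 : ℝ) < ε := hε
  have hle : dist (fun i => (φ (F.equivFin.symm i)).val e) (fun i => w (F.equivFin.symm i))
      ≤ 1 := by
    rw [dist_pi_le_iff zero_le_one]
    intro i
    rw [Subtype.dist_eq, Real.dist_eq, abs_le]
    constructor <;> linarith [unitInterval.nonneg ((φ (F.equivFin.symm i)).val e),
      unitInterval.nonneg (w (F.equivFin.symm i)),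
      unitInterval.le_one ((φ (F.equivFin.symm i)).val e),
      unitInterval.le_one (w (F.equivFin.symm i))]
  rw [Set.projIcc_of_mem zero_le_one ⟨dist_nonneg, hle⟩, ← Subtype.coe_lt_coe]
  change dist _ _ < _ ↔ _
  rw [dist_pi_lt_iff hε']
  constructor
  · intro h q hq
    simpa using h (F.equivFin ⟨q, hq⟩)
  · intro h i
    exact h _ (F.equivFin.symm i).2

end Substitution

/-! ### Saturation and indiscernible families over linear orders -/

section Saturation

variable {L : ContLanguage.{u, v}} {U : Type w} [MetricSpace U] [ContStructure L U]

theorem IsSaturated.realize_of_approx_fin {κ : Cardinal.{w}} (hκ : Cardinal.aleph0 < κ)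
    (hU : IsSaturated L U κ) {P : Type} [Countable P] (e : P → U) {k : ℕ} {S : Type*}
    (χ : S → Formula L (Fin k ⊕ P)) (w : S → unitInterval)
    (h : ∀ F : Finset S, ∀ ε > 0, ∃ d : Fin k → U, ∀ s ∈ F,
      dist ((χ s).val (Sum.elim d e)) (w s) < ε) :
    ∃ d : Fin k → U, ∀ s, (χ s).val (Sum.elim d e) = w s := by
  classical
  let A : Set U := Set.range e
  let g : Fin k ⊕ P → A ⊕ Fin k := Sum.elim Sum.inr (fun p => Sum.inl ⟨e p, p, rfl⟩)
  have hg : ∀ d : Fin k → U, Sum.elim (fun a : A => (a : U)) d ∘ g = Sum.elim d e := by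
    intro d
    funext z
    cases z <;> rfl
  -- Closed conditions have the form `= 0`; the equality with `w s` is split into the conditions
  -- that the distance is at most `1 / (n + 1)`. Truncation at `0` turns each of these into a
  -- vanishing value.
  let cond : S × ℕ → Formula L (A ⊕ Fin k) := fun s =>
    .conn (k := 1) ⟨fun t => Set.projIcc (0 : ℝ) 1 zero_le_one
      (dist (t 0) (w s.1) - 1 / ((s.2 : ℝ) + 1)), by fun_prop⟩ (fun _ => (χ s.1).rename g)
  have hcond : ∀ (s : S × ℕ) (d : Fin k → U),
      (cond s).val (Sum.elim (fun a : A => (a : U)) d) = 0 ↔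
        dist ((χ s.1).val (Sum.elim d e)) (w s.1) ≤ 1 / ((s.2 : ℝ) + 1) := by
    intro s d
    have h1 : (cond s).val (Sum.elim (fun a : A => (a : U)) d) =
        Set.projIcc (0 : ℝ) 1 zero_le_one
          (dist (((χ s.1).rename g).val (Sum.elim (fun a : A => (a : U)) d)) (w s.1)
            - 1 / ((s.2 : ℝ) + 1)) := rfl
    rw [h1, val_rename, hg]
    refine (Set.projIcc_eq_left (zero_lt_one' ℝ)).trans ?_
    rw [sub_nonpos]
  have hA : Cardinal.mk A < κ :=
    (Cardinal.mk_le_aleph0_iff.2 (Set.countable_range e).to_subtype).trans_lt hκ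
  obtain ⟨d, hd⟩ := hU A hA k (Set.range cond) (by
    intro Γ₀ hΓ₀
    rw [← Set.image_univ] at hΓ₀
    obtain ⟨T, -, rfl⟩ := Finset.subset_set_image_iff.1 hΓ₀
    obtain ⟨n, hn⟩ : ∃ n : ℕ, ∀ s ∈ T, s.2 ≤ n :=
      ⟨T.sup Prod.snd, fun s hs => Finset.le_sup (f := Prod.snd) hs⟩
    obtain ⟨d, hd⟩ := h (T.image Prod.fst) (1 / ((n : ℝ) + 1)) (by positivity)
    refine ⟨d, fun φ hφ => ?_⟩
    obtain ⟨s, hs, rfl⟩ := Finset.mem_image.1 hφ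
    rw [hcond]
    refine (hd s.1 (Finset.mem_image_of_mem _ hs)).le.trans ?_
    have : (s.2 : ℝ) ≤ n := by exact_mod_cast hn s hs
    gcongr)
  refine ⟨d, fun s => eq_of_dist_eq_zero (le_antisymm ?_ dist_nonneg)⟩
  refine ge_of_tendsto' tendsto_one_div_add_atTop_nhds_zero_nat fun n => ?_
  exact (hcond (s, n) d).1 (hd _ ⟨(s, n), rfl⟩)

/-- In an uncountably saturated structure, a system of exact conditions with countably many
parameters is satisfied as soon as its finite parts are approximately satisfied. -/
theorem IsSaturated.realize_of_approx {κ : Cardinal.{w}} (hκ : Cardinal.aleph0 < κ)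
    (hU : IsSaturated L U κ) {P : Type} [Countable P] (e : P → U) {ι : Type} [Finite ι]
    {S : Type*} (χ : S → Formula L (ι ⊕ P)) (w : S → unitInterval)
    (h : ∀ F : Finset S, ∀ ε > 0, ∃ d : ι → U, ∀ s ∈ F,
      dist ((χ s).val (Sum.elim d e)) (w s) < ε) :
    ∃ d : ι → U, ∀ s, (χ s).val (Sum.elim d e) = w s := by
  obtain ⟨k, ⟨f⟩⟩ := Finite.exists_equiv_fin ι
  have hf : ∀ d : Fin k → U, Sum.elim d e ∘ Sum.map f id = Sum.elim (d ∘ f) e := by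
    intro d
    rw [Sum.elim_comp_map, Function.comp_id]
  obtain ⟨d, hd⟩ := hU.realize_of_approx_fin hκ e (fun s => (χ s).rename (Sum.map f id)) w (by
    intro F ε hε
    obtain ⟨d, hd⟩ := h F ε hε
    refine ⟨d ∘ f.symm, fun s hs => ?_⟩
    rw [val_rename, hf, Function.comp_assoc, f.symm_comp_self, Function.comp_id]
    exact hd s hs)
  refine ⟨d ∘ f, fun s => ?_⟩
  rw [← hd s, val_rename, hf]

/-- Indiscernibility of a family of tuples indexed by a linear order. -/
def OrderIndiscernible (L : ContLanguage.{u, v}) [ContStructure L U] {I : Type} [LinearOrder I]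
    {ι : Type} (a : I → ι → U) : Prop :=
  ∀ (n : ℕ) (χ : Formula L (Fin n × ι)) (s t : Fin n → I), StrictMono s → StrictMono t →
    χ.val (fun p => a (s p.1) p.2) = χ.val (fun p => a (t p.1) p.2)

/-- Only the order type of the positions matters. Enumerating the image of `σ` increasingly reduces
to strictly monotone positions; repetitions are covered because order equivalence in both directions
forces the same ties in `τ`. -/
theorem OrderIndiscernible.val_eq {I : Type} [LinearOrder I] {ι : Type} {a : I → ι → U}
    (ha : OrderIndiscernible L a) {Q : Type} [Finite Q] (χ : Formula L Q) (σ τ : Q → I)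
    (g : Q → ι) (hστ : ∀ q q', σ q < σ q' ↔ τ q < τ q') :
    χ.val (fun q => a (σ q) (g q)) = χ.val (fun q => a (τ q) (g q)) := by
  classical
  cases nonempty_fintype Q
  let F : Finset I := Finset.univ.image σ
  let s : Fin F.card → I := F.orderEmbOfFin rfl
  have hs : StrictMono s := (F.orderEmbOfFin rfl).strictMono
  have hrange : Set.range s = F := Finset.range_orderEmbOfFin F rfl
  have h1 : ∀ q, ∃ x, s x = σ q := fun q => by
    have : σ q ∈ Set.range s := by rw [hrange]; simp [F]
    exact this
  have h2 : ∀ x, ∃ q, σ q = s x := fun x => by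
    have : s x ∈ (F : Set I) := by rw [← hrange]; exact ⟨x, rfl⟩
    simpa [F] using this
  choose x hx using h1
  choose y hy using h2
  have ht : StrictMono (τ ∘ y) := fun i j hij => by
    have := hs hij
    rw [← hy, ← hy, hστ] at this
    exact this
  have hτ : ∀ q, τ (y (x q)) = τ q := fun q => by
    have h0 : σ (y (x q)) = σ q := by rw [hy, hx]
    have h3 := (hστ (y (x q)) q).not.1 h0.not_lt
    have h4 := (hστ q (y (x q))).not.1 h0.not_gt
    exact le_antisymm (not_lt.1 h4) (not_lt.1 h3)
  have h := ha F.card (χ.rename fun q => (x q, g q)) s (τ ∘ y) hs ht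
  rw [val_rename, val_rename] at h
  simpa only [Function.comp_def, hx, hτ] using h

/-- A family of values of instances of formulas over an indiscernible family is realized as soon
as its finite parts are approximately realized over index sets of the same order type. -/
theorem OrderIndiscernible.realize_of_approx {κ : Cardinal.{w}} (hκ : Cardinal.aleph0 < κ)
    (hU : IsSaturated L U κ) {I : Type} [LinearOrder I] [Countable I] {ι : Type} [Finite ι]
    {a : I → ι → U} (ha : OrderIndiscernible L a) {k : ℕ} {Q : Type}
    (φ : Q → Formula L (Fin k ⊕ ι)) (σ : Q → I) (w : Q → unitInterval)
    (h : ∀ F : Finset Q, ∀ ε > 0, ∃ (τ : Q → I) (d : Fin k → U),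
      (∀ q ∈ F, ∀ q' ∈ F, σ q < σ q' ↔ τ q < τ q') ∧
      ∀ q ∈ F, dist ((φ q).val (Sum.elim d (a (τ q)))) (w q) < ε) :
    ∃ d : Fin k → U, ∀ q, (φ q).val (Sum.elim d (a (σ q))) = w q := by
  classical
  have hg : ∀ (q : Q) (d : Fin k → U), Sum.elim d (fun p : I × ι => a p.1 p.2) ∘
      Sum.map id (fun i => (σ q, i)) = Sum.elim d (a (σ q)) := by
    intro q d
    rw [Sum.elim_comp_map, Function.comp_id]
    rfl
  obtain ⟨d, hd⟩ := hU.realize_of_approx hκ (fun p : I × ι => a p.1 p.2)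
    (fun q => (φ q).rename (Sum.map id (fun i => (σ q, i)))) w (by
    intro F ε hε
    obtain ⟨δ, hδ, hδε⟩ : ∃ δ : unitInterval, 0 < δ ∧ (δ : ℝ) ≤ ε :=
      ⟨⟨min ε 1, by positivity, min_le_right _ _⟩, by
        rw [← Subtype.coe_lt_coe]; exact lt_min hε one_pos, min_le_left _ _⟩
    obtain ⟨τ, d, hτ, hd⟩ := h F δ hδ
    let ψ : F → Formula L (Fin k ⊕ (F × ι)) := fun q =>
      (φ q).rename (Sum.map id (fun i => (q, i)))
    have hψ : ∀ (q : F) (d : Fin k → U) (ρ : Q → I),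
        (ψ q).val (Sum.elim d fun p : F × ι => a (ρ p.1) p.2) =
          (φ q).val (Sum.elim d (a (ρ q))) := by
      intro q d ρ
      rw [val_rename, Sum.elim_comp_map, Function.comp_id]
      rfl
    have hlt : (deviation ψ (fun q : F => w q) Finset.univ).infTuple.val
        (fun p : F × ι => a (τ p.1) p.2) < δ := by
      rw [val_infTuple_lt_iff]
      refine ⟨d, (val_deviation_lt_iff _ _ _ _ hδ).2 fun q _ => ?_⟩
      rw [hψ]
      exact hd q q.2
    -- The existence of an approximate solution is the condition `inf < δ` on the parameters alone,
    -- so it passes from the positions `τ` to `σ`.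
    rw [← ha.val_eq _ (fun p : F × ι => σ p.1) (fun p : F × ι => τ p.1) (fun p => p.2)
      (fun p p' => hτ _ p.1.2 _ p'.1.2), val_infTuple_lt_iff] at hlt
    obtain ⟨d', hd'⟩ := hlt
    rw [val_deviation_lt_iff _ _ _ _ hδ] at hd'
    refine ⟨d', fun q hq => ?_⟩
    have := hd' ⟨q, hq⟩ (Finset.mem_univ _)
    rw [hψ] at this
    rw [val_rename, hg]
    exact this.trans_le hδε)
  refine ⟨d, fun q => ?_⟩
  rw [← hd q, val_rename, hg]

/-- An indiscernible sequence extends by a further tuple placed after all its members. -/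
theorem exists_orderIndiscernible_withTop {κ : Cardinal.{w}} (hκ : Cardinal.aleph0 < κ)
    (hU : IsSaturated L U κ) {ι : Type} [Finite ι] {a : ℕ → ι → U}
    (ha : OrderIndiscernible L a) :
    ∃ A : WithTop ℕ → ι → U, OrderIndiscernible L A ∧ ∀ n : ℕ, A n = a n := by
  classical
  let e : ℕ × ι → U := fun p => a p.1 p.2
  let Φ : ℕ → Formula L (ι ⊕ (ℕ × ι)) → unitInterval := fun N χ => χ.val (Sum.elim (a N) e)
  let 𝒰 : Ultrafilter ℕ := Filter.hyperfilter ℕ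
  -- `W` is the limit type of the `a N` over the whole sequence, along a nonprincipal ultrafilter;
  -- its realization `t` becomes the last tuple.
  obtain ⟨W, hW⟩ : ∃ W, Tendsto Φ 𝒰 (𝓝 W) := by
    obtain ⟨W, -, hW⟩ := isCompact_univ.ultrafilter_le_nhds (𝒰.map Φ) (by simp)
    exact ⟨W, hW⟩
  obtain ⟨t, ht⟩ := hU.realize_of_approx hκ e (fun χ => χ) W (by
    intro F ε hε
    have : ∀ᶠ N in (𝒰 : Filter ℕ), ∀ χ ∈ F, dist (Φ N χ) (W χ) < ε := by
      rw [Filter.eventually_all_finset]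
      intro χ _
      exact (tendsto_pi_nhds.1 hW χ).eventually (Metric.ball_mem_nhds _ hε)
    obtain ⟨N, hN⟩ := this.exists
    exact ⟨a N, hN⟩)
  let A : WithTop ℕ → ι → U := fun i => WithTop.recTopCoe t a i
  refine ⟨A, ?_, fun n => rfl⟩
  have key : ∀ (n : ℕ) (χ : Formula L (Fin n × ι)) (s : Fin n → WithTop ℕ), StrictMono s →
      χ.val (fun p => A (s p.1) p.2) = χ.val (fun p : Fin n × ι => a p.1 p.2) := by
    intro n χ s hs
    let g : Fin n × ι → ι ⊕ (ℕ × ι) := fun p =>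
      WithTop.recTopCoe (Sum.inl p.2) (fun i : ℕ => Sum.inr (i, p.2)) (s p.1)
    have h1 : (χ.rename g).val (Sum.elim t e) = χ.val (fun p => A (s p.1) p.2) := by
      rw [val_rename]
      congr 1
      funext p
      simp only [g, A, Function.comp_apply]
      induction s p.1 using WithTop.recTopCoe <;> rfl
    have h2 : ∀ᶠ N : ℕ in atTop, ∀ x : Fin n, ∀ i : ℕ, s x = i → i < N := by
      rw [Filter.eventually_all]
      intro x
      induction s x using WithTop.recTopCoe with
      | top => exact Filter.Eventually.of_forall fun N i h => by simp at h
      | coe j =>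
        filter_upwards [eventually_gt_atTop j] with N hN i h
        have : j = i := WithTop.coe_injective h
        omega
    -- Replacing `⊤` by a large `N` gives an increasing tuple of natural numbers, where
    -- indiscernibility of `a` applies.
    have h3 : ∀ᶠ N : ℕ in atTop, Φ N (χ.rename g) = χ.val (fun p : Fin n × ι => a p.1 p.2) := by
      filter_upwards [h2] with N hN
      let s' : Fin n → ℕ := fun x => WithTop.recTopCoe N (fun i => i) (s x)
      have hs' : StrictMono s' := by
        intro x y hxy
        have h := hs hxy
        have hx := hN x
        simp only [s']
        revert h hx
        induction s x using WithTop.recTopCoe <;> induction s y using WithTop.recTopCoe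
        · simp
        · simp
        · intro _ h
          exact h _ rfl
        · intro h _
          exact_mod_cast h
      rw [← ha n χ s' (fun x => x) hs' (fun x y h => h)]
      simp only [Φ]
      rw [val_rename]
      congr 1
      funext p
      simp only [g, s', Function.comp_apply]
      induction s p.1 using WithTop.recTopCoe <;> rfl
    have h4 : Tendsto (fun N => Φ N (χ.rename g)) 𝒰 (𝓝 (W (χ.rename g))) :=
      tendsto_pi_nhds.1 hW _
    have h5 : Tendsto (fun N => Φ N (χ.rename g)) 𝒰
        (𝓝 (χ.val (fun p : Fin n × ι => a p.1 p.2))) :=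
      tendsto_const_nhds.congr' (Filter.EventuallyEq.symm (Nat.hyperfilter_le_atTop h3))
    rw [← h1, ht]
    exact tendsto_nhds_unique h4 h5
  intro n χ s s' hs hs'
  rw [key n χ s hs, key n χ s' hs']

end Saturation

/-! ### Compact sets of convergent sequences closed under subsequences -/

section SequenceSpaces

theorem exists_mem_forall_of_isCompact {X : Type*} [TopologicalSpace X] {V : Set X}
    (hV : IsCompact V) (C : ℕ → Set X) (hC : ∀ i, IsClosed (C i))
    (h : ∀ p, ∃ w ∈ V, ∀ i < p, w ∈ C i) : ∃ w ∈ V, ∀ i, w ∈ C i := by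
  obtain ⟨w, hwV, hw⟩ := hV.inter_iInter_nonempty C hC (by
    intro F
    obtain ⟨w, hwV, hw⟩ := h (F.sup id + 1)
    refine ⟨w, hwV, Set.mem_iInter₂.2 fun i hi => hw i ?_⟩
    exact Nat.lt_succ_of_le (Finset.le_sup (f := id) hi))
  exact ⟨w, hwV, Set.mem_iInter.1 hw⟩

/-- Subsequences of infinite sequences are indexed by all of `ℕ`, so the enumeration of `S` is
continued arbitrarily beyond its last element. -/
theorem exists_strictMono_mem_finset (S : Finset ℕ) :
    ∃ e : ℕ → ℕ, StrictMono e ∧ ∀ i < S.card, e i ∈ S := by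
  refine ⟨fun i => if h : i < S.card then S.orderEmbOfFin rfl ⟨i, h⟩ else S.sup id + 1 + i,
    ?_, fun i hi => ?_⟩
  · refine strictMono_nat_of_lt_succ fun i => ?_
    by_cases h : i + 1 < S.card
    · simp only [h, (Nat.lt_succ_self i).trans h, dif_pos]
      exact (S.orderEmbOfFin rfl).strictMono (Nat.lt_succ_self i)
    · by_cases h' : i < S.card
      · simp only [h, h', dif_pos, dif_neg, not_false_eq_true]
        have := Finset.le_sup (f := id) (S.orderEmbOfFin_mem rfl ⟨i, h'⟩)
        simp only [id] at this
        omega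
      · simp only [h, h', dif_neg, not_false_eq_true]
        omega
  · simp only [hi, dif_pos]
    exact S.orderEmbOfFin_mem rfl _

variable {V : Set (ℕ → ℝ)}

/-- In a compact set of convergent sequences that is closed under subsequences, the number of
disjoint drops of a given size is bounded. -/
theorem exists_card_drops_le (hV : IsCompact V)
    (hsub : ∀ w ∈ V, ∀ t : ℕ → ℕ, StrictMono t → w ∘ t ∈ V)
    (hconv : ∀ w ∈ V, ∃ l, Tendsto w atTop (𝓝 l)) {η : ℝ} (hη : 0 < η) :
    ∃ N : ℕ, ∀ w ∈ V, ∀ S : Finset ℕ, (∀ k ∈ S, η ≤ w (2 * k) - w (2 * k + 1)) →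
      S.card ≤ N := by
  by_contra! hcon
  -- Passing to a subsequence packs the drops at the front; by compactness some member of `V` drops
  -- at every pair `(2i, 2i + 1)`, so it cannot converge.
  obtain ⟨w, hwV, hw⟩ := exists_mem_forall_of_isCompact hV
    (fun i => {w : ℕ → ℝ | η ≤ w (2 * i) - w (2 * i + 1)})
    (fun i => isClosed_le (by fun_prop) (by fun_prop)) (by
      intro p
      obtain ⟨w, hwV, S, hS, hp⟩ := hcon p
      obtain ⟨e, he, heS⟩ := exists_strictMono_mem_finset S
      refine ⟨w ∘ fun n => 2 * e (n / 2) + n % 2, hsub w hwV _ ?_, fun i hi => ?_⟩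
      · refine strictMono_nat_of_lt_succ fun n => ?_
        have h1 := he (Nat.lt_succ_self (n / 2))
        rcases Nat.even_or_odd' n with ⟨m, rfl | rfl⟩
        · have h2 : (2 * m + 1) / 2 = m := by omega
          have h3 : 2 * m / 2 = m := by omega
          rw [h2, h3]; omega
        · have h2 : (2 * m + 1 + 1) / 2 = m + 1 := by omega
          have h3 : (2 * m + 1) / 2 = m := by omega
          rw [h3, Nat.succ_eq_add_one] at h1
          rw [h2, h3]; omega
      · have h2 : (2 * i + 1) / 2 = i := by omega
        have h3 : 2 * i / 2 = i := by omega
        have h4 : (2 * i + 1) % 2 = 1 := by omega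
        have h5 : 2 * i % 2 = 0 := by omega
        simp only [Set.mem_ofPred_eq, Function.comp_apply, h2, h3, h4, h5, add_zero]
        exact hS _ (heS i (hi.trans hp)))
  obtain ⟨l, hl⟩ := hconv w hwV
  have h1 : Tendsto (fun i : ℕ => w (2 * i)) atTop (𝓝 l) :=
    hl.comp (strictMono_mul_left_of_pos two_pos).tendsto_atTop
  have h2 : Tendsto (fun i : ℕ => w (2 * i + 1)) atTop (𝓝 l) :=
    hl.comp (StrictMono.tendsto_atTop fun a b h => by omega)
  have h3 := ge_of_tendsto' (h1.sub h2) hw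
  linarith

/-- From the pattern `w_j(i) + ε < w_i(j)` for `i < j` one obtains sequences that are low on an
initial segment of given length and high afterwards. -/
theorem exists_low_high (hV : IsCompact V)
    (hsub : ∀ w ∈ V, ∀ t : ℕ → ℕ, StrictMono t → w ∘ t ∈ V)
    (hconv : ∀ w ∈ V, ∃ l, Tendsto w atTop (𝓝 l)) (w : ℕ → ℕ → ℝ) (hw : ∀ j, w j ∈ V)
    {ε : ℝ} (hε : 0 < ε) (hlt : ∀ i j, i < j → w j i + ε < w i j) :
    ∃ r s : ℝ, r < s ∧ ∀ p : ℕ, ∃ v ∈ V, (∀ i < p, v i ≤ r) ∧ ∀ i, p ≤ i → s ≤ v i := by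
  let 𝒰 : Ultrafilter ℕ := Filter.hyperfilter ℕ
  have h𝒰 : (𝒰 : Filter ℕ) ≤ atTop := Nat.hyperfilter_le_atTop
  obtain ⟨x, hxV, hx⟩ := hV.ultrafilter_le_nhds (𝒰.map w) (by
    rw [Filter.le_principal_iff]
    exact Filter.mem_map.2 (Filter.univ_mem' hw))
  have hx' : ∀ i, Tendsto (fun j => w j i) 𝒰 (𝓝 (x i)) := fun i =>
    tendsto_pi_nhds.1 (show Tendsto w 𝒰 (𝓝 x) from hx) i
  obtain ⟨L, hL⟩ := hconv x hxV
  choose l hl using fun i => hconv (w i) (hw i)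
  have hxl : ∀ i, x i + ε ≤ l i := fun i => by
    refine le_of_tendsto_of_tendsto ((hx' i).add_const ε) ((hl i).mono_left h𝒰) ?_
    exact h𝒰 ((eventually_gt_atTop i).mono fun j hj => (hlt i j hj).le)
  refine ⟨L + ε / 4, L + 3 * ε / 4, by linarith, fun p => ?_⟩
  obtain ⟨I₀, hI₀⟩ := Metric.tendsto_atTop.1 hL (ε / 8) (by linarith)
  obtain ⟨j, hj, hjI⟩ : ∃ j, (∀ i ∈ Finset.range p, w j (I₀ + i) < x (I₀ + i) + ε / 8) ∧
      I₀ ≤ j := by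
    refine ((?_ : ∀ᶠ j in (𝒰 : Filter ℕ), _).and (h𝒰 (eventually_ge_atTop I₀))).exists
    rw [Filter.eventually_all_finset]
    exact fun i _ => (hx' _).eventually_lt_const (by linarith)
  -- On `p` positions from `I₀` on, `w j` is close to `x`, hence to `L`; its own limit `l j` is at
  -- least `x j + ε`. Skipping `N` further positions leaves only values near `l j`.
  obtain ⟨N, hN⟩ := Metric.tendsto_atTop.1 (hl j) (ε / 8) (by linarith)
  refine ⟨_, hsub _ (hw j) (fun i => if i < p then I₀ + i else I₀ + i + N) ?_, ?_, ?_⟩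
  · intro a b hab
    simp only
    split_ifs <;> omega
  · intro i hi
    have h1 := hj i (Finset.mem_range.2 hi)
    have h2 := (abs_lt.1 (hI₀ (I₀ + i) (by omega))).2
    simp only [Function.comp_apply, hi, if_true]
    linarith
  · intro i hi
    have h1 := (abs_lt.1 (hN (I₀ + i + N) (by omega))).1
    have h2 := (abs_lt.1 (hI₀ j hjI)).1
    have h3 := hxl j
    simp only [Function.comp_apply, not_lt.2 hi, if_false]
    linarith

/-- Here `b η` will bound the number of drops of size `η`. A drop across band `i` has size at least
`θ i / 2` and raises the level by `θ (i + 1)`, so the last clause bounds by `γ` the total rise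
caused by band `i`. -/
theorem exists_thresholds (b : ℝ → ℕ) {δ γ : ℝ} (hδ : 0 < δ) (hγ : 0 < γ) :
    ∃ θ : ℕ → ℝ, θ 0 = δ ∧ (∀ i, 0 < θ i) ∧ (∀ i, θ (i + 1) ≤ θ i / 2) ∧
      ∀ i, b (θ i / 2) * θ (i + 1) ≤ γ := by
  let θ : ℕ → ℝ := fun i => Nat.rec δ (fun _ x => min (x / 2) (γ / (b (x / 2) + 1))) i
  have hs : ∀ i, θ (i + 1) = min (θ i / 2) (γ / (b (θ i / 2) + 1)) := fun i => rfl
  have hpos : ∀ i, 0 < θ i := by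
    intro i
    induction i with
    | zero => exact hδ
    | succ i ih => rw [hs]; positivity
  refine ⟨θ, rfl, hpos, fun i => by rw [hs]; exact min_le_left _ _, fun i => ?_⟩
  have h1 : θ (i + 1) ≤ γ / (b (θ i / 2) + 1) := by rw [hs]; exact min_le_right _ _
  rw [le_div_iff₀ (by positivity)] at h1
  nlinarith [hpos (i + 1)]

/-- The lower level reached after drops across the bands `j 0, …, j (K - 1)`. -/
def level (r : ℝ) (θ : ℕ → ℝ) (j : ℕ → ℕ) (K : ℕ) : ℝ :=
  r + ∑ k ∈ Finset.range K, θ (j k + 1)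

/-- The sequence `w` begins with drops across the bands `j 0, …, j (K - 1)`. -/
def HasDrops (r : ℝ) (θ : ℕ → ℝ) (j : ℕ → ℕ) (K : ℕ) (w : ℕ → ℝ) : Prop :=
  ∀ k < K, level r θ j k + θ (j k) ≤ w (2 * k) ∧ w (2 * k + 1) ≤ level r θ j (k + 1)

/-- The prescribed drops can be followed in `V` by long low and then long high segments. -/
def Stage (V : Set (ℕ → ℝ)) (r s : ℝ) (θ : ℕ → ℝ) (j : ℕ → ℕ) (K : ℕ) : Prop :=
  ∀ p : ℕ, ∃ w ∈ V, HasDrops r θ j K w ∧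
    (∀ x, 2 * K ≤ x → x < 2 * K + p → w x ≤ level r θ j K) ∧
    ∀ x, 2 * K + p ≤ x → x < 2 * K + 2 * p → s ≤ w x

theorem level_succ (r : ℝ) (θ : ℕ → ℝ) (j : ℕ → ℕ) (K : ℕ) :
    level r θ j (K + 1) = level r θ j K + θ (j K + 1) := by
  rw [level, level, Finset.sum_range_succ, add_assoc]

theorem level_congr {r : ℝ} {θ : ℕ → ℝ} {j j' : ℕ → ℕ} {K : ℕ} (h : ∀ k < K, j k = j' k) :
    level r θ j K = level r θ j' K := by
  unfold level
  rw [Finset.sum_congr rfl fun k hk => by rw [h k (Finset.mem_range.1 hk)]]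

theorem isClosed_hasDrops (r : ℝ) (θ : ℕ → ℝ) (j : ℕ → ℕ) (K : ℕ) :
    IsClosed {w | HasDrops r θ j K w} := by
  simp only [HasDrops, Set.ofPred_forall, Set.ofPred_and]
  exact isClosed_iInter fun k => isClosed_iInter fun _ =>
    (isClosed_le (by fun_prop) (by fun_prop)).inter (isClosed_le (by fun_prop) (by fun_prop))

/-- There is a stage at which no drop across any of the first `J` bands can be added. -/
theorem exists_maximal_stage (hV : IsCompact V)
    (hsub : ∀ w ∈ V, ∀ t : ℕ → ℕ, StrictMono t → w ∘ t ∈ V)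
    (hconv : ∀ w ∈ V, ∃ l, Tendsto w atTop (𝓝 l)) {r s : ℝ} (hrs : r < s)
    (hlh : ∀ p : ℕ, ∃ v ∈ V, (∀ i < p, v i ≤ r) ∧ ∀ i, p ≤ i → s ≤ v i)
    {J : ℕ} (hJ : 0 < J) :
    ∃ (θ : ℕ → ℝ) (j : ℕ → ℕ) (K P : ℕ), (∀ i, 0 < θ i) ∧ (∀ i, θ (i + 1) ≤ θ i / 2) ∧
      level r θ j K + θ 0 ≤ s ∧ Stage V r s θ j K ∧
      ∀ i < J, ∀ w ∈ V, HasDrops r θ j K w → level r θ j K + θ i ≤ w (2 * K) →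
        (∀ x, 2 * K < x → x ≤ 2 * K + P → w x ≤ level r θ j K + θ (i + 1)) →
        ¬ ∀ x, 2 * K + P < x → x ≤ 2 * K + 2 * P → s ≤ w x := by
  have hb : ∀ η : ℝ, ∃ N : ℕ, 0 < η → ∀ w ∈ V, ∀ S : Finset ℕ,
      (∀ k ∈ S, η ≤ w (2 * k) - w (2 * k + 1)) → S.card ≤ N := by
    intro η
    by_cases hη : 0 < η
    · obtain ⟨N, hN⟩ := exists_card_drops_le hV hsub hconv hη
      exact ⟨N, fun _ => hN⟩
    · exact ⟨0, fun h => absurd h hη⟩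
  choose b hb using hb
  have hJ' : (0 : ℝ) < J := by exact_mod_cast hJ
  -- The `J` bands raise the level by at most `(s - r) / 2` in total; with `θ 0 = (s - r) / 2` all
  -- bands above the final level stay below `s`.
  obtain ⟨θ, hθ0, hpos, hhalf, hsmall⟩ := exists_thresholds b
    (δ := (s - r) / 2) (γ := (s - r) / 2 / J) (by linarith)
    (div_pos (by linarith) hJ')
  have hcount : ∀ (j : ℕ → ℕ) (K : ℕ), Stage V r s θ j K → ∀ i,
      ((Finset.range K).filter fun k => j k = i).card ≤ b (θ i / 2) := by
    intro j K hst i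
    obtain ⟨w, hwV, hw, -, -⟩ := hst 0
    refine hb _ (half_pos (hpos i)) w hwV _ fun k hk => ?_
    obtain ⟨hkK, rfl⟩ := Finset.mem_filter.1 hk
    have h1 := hw k (Finset.mem_range.1 hkK)
    rw [level_succ] at h1
    linarith [hhalf (j k), h1.1, h1.2]
  let A : Set ℕ := {K | ∃ j : ℕ → ℕ, (∀ k, j k < J) ∧ Stage V r s θ j K}
  have hA0 : 0 ∈ A := by
    refine ⟨fun _ => 0, fun _ => hJ, fun p => ?_⟩
    obtain ⟨v, hvV, h1, h2⟩ := hlh p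
    refine ⟨v, hvV, fun k hk => absurd hk (Nat.not_lt_zero k), fun x _ hx => ?_, fun x hx _ => ?_⟩
    · simpa [level] using h1 x (by omega)
    · exact h2 x (by omega)
  have hAb : ∀ K ∈ A, K ≤ ∑ i ∈ Finset.range J, b (θ i / 2) := by
    rintro K ⟨j, hj, hst⟩
    have h1 := Finset.card_eq_sum_card_fiberwise (f := j) (s := Finset.range K)
      (t := Finset.range J) (fun k _ => by simpa using hj k)
    rw [Finset.card_range] at h1
    rw [h1]
    exact Finset.sum_le_sum fun i _ => hcount j K hst i
  -- Each of the `J` bands admits boundedly many drops, so the number of prescribed drops cannot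
  -- grow for ever.
  obtain ⟨K, ⟨j, hj, hst⟩, hK⟩ : ∃ K ∈ A, K + 1 ∉ A := by
    by_contra! hcon
    have hall : ∀ K, K ∈ A := fun K => by
      induction K with
      | zero => exact hA0
      | succ K ih => exact hcon K ih
    exact absurd (hAb _ (hall (∑ i ∈ Finset.range J, b (θ i / 2) + 1))) (by omega)
  have hlevel : level r θ j K + θ 0 ≤ s := by
    have h1 : ∑ k ∈ Finset.range K, θ (j k + 1) =
        ∑ i ∈ Finset.range J, ∑ k ∈ (Finset.range K).filter (fun k => j k = i), θ (j k + 1) :=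
      (Finset.sum_fiberwise_of_maps_to (fun k _ => by simpa using hj k) _).symm
    have h2 : ∑ k ∈ Finset.range K, θ (j k + 1) ≤ ∑ i ∈ Finset.range J, (s - r) / 2 / J := by
      rw [h1]
      refine Finset.sum_le_sum fun i _ => ?_
      rw [Finset.sum_congr rfl fun k hk => by rw [(Finset.mem_filter.1 hk).2],
        Finset.sum_const, nsmul_eq_mul]
      refine le_trans ?_ (hsmall i)
      have := hcount j K hst i
      have h3 := (hpos (i + 1)).le
      gcongr
    rw [Finset.sum_const, Finset.card_range, nsmul_eq_mul, mul_div_cancel₀ _ hJ'.ne'] at h2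
    rw [level, hθ0]
    linarith
  have hext : ∀ i, ∃ p : ℕ, i < J → ∀ w ∈ V, HasDrops r θ j K w →
      level r θ j K + θ i ≤ w (2 * K) → w (2 * K + 1) ≤ level r θ j K + θ (i + 1) →
      (∀ x, 2 * (K + 1) ≤ x → x < 2 * (K + 1) + p → w x ≤ level r θ j K + θ (i + 1)) →
      ¬ ∀ x, 2 * (K + 1) + p ≤ x → x < 2 * (K + 1) + 2 * p → s ≤ w x := by
    intro i
    by_cases hi : i < J
    swap
    · exact ⟨0, fun h => absurd h hi⟩
    let j' : ℕ → ℕ := fun k => if k < K then j k else i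
    have hj' : ∀ k < K, j' k = j k := fun k hk => if_pos hk
    have hlev : ∀ k ≤ K, level r θ j' k = level r θ j k := fun k hk =>
      level_congr fun k' hk' => hj' k' (hk'.trans_le hk)
    have hjK : j' K = i := if_neg (lt_irrefl K)
    have hlevK : level r θ j' (K + 1) = level r θ j K + θ (i + 1) := by
      rw [level_succ, hlev K le_rfl, hjK]
    have hnot : ¬ Stage V r s θ j' (K + 1) := fun h =>
      hK ⟨j', fun k => by simp only [j']; split_ifs; exacts [hj k, hi], h⟩
    simp only [Stage, not_forall] at hnot
    obtain ⟨p, hp⟩ := hnot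
    refine ⟨p, fun _ w hwV hw h1 h2 h3 h4 => hp ⟨w, hwV, fun k hk => ?_, ?_, h4⟩⟩
    · rcases Nat.lt_succ_iff_lt_or_eq.1 hk with hk | rfl
      · rw [hlev k hk.le, hlev (k + 1) hk, hj' k hk]
        exact hw k hk
      · rw [hlevK, hlev k le_rfl, hjK]
        exact ⟨h1, h2⟩
    · rw [hlevK]
      exact h3
  choose p hp using hext
  -- One length that works for every band; the extra `1` is for position `2K + 1`, the lower end of
  -- the new drop.
  let P : ℕ := (Finset.range J).sup p + 1
  refine ⟨θ, j, K, P, hpos, hhalf, hlevel, hst, fun i hi w hwV hw h1 h2 h3 => ?_⟩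
  have hpP : p i + 1 ≤ P := Nat.succ_le_succ (Finset.le_sup (f := p) (Finset.mem_range.2 hi))
  -- Deleting `P - 1 - p i` low positions shortens the low run from `P` to `1 + p i`, so that the
  -- high run begins where `hp` expects it.
  refine hp i hi (w ∘ fun x => if x < 2 * K + 2 + p i then x else x + (P - 1 - p i))
    (hsub w hwV _ ?_) (fun k hk => ?_) ?_ ?_ (fun x hx hx' => ?_) (fun x hx hx' => ?_)
  · intro x y hxy
    simp only
    split_ifs <;> omega
  · have h4 : 2 * k < 2 * K + 2 + p i := by omega
    have h5 : 2 * k + 1 < 2 * K + 2 + p i := by omega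
    simp only [Function.comp_apply, h4, h5, if_true]
    exact hw k hk
  · have h4 : 2 * K < 2 * K + 2 + p i := by omega
    simp only [Function.comp_apply, h4, if_true]
    exact h1
  · have h4 : 2 * K + 1 < 2 * K + 2 + p i := by omega
    simp only [Function.comp_apply, h4, if_true]
    exact h2 _ (by omega) (by omega)
  · have h4 : x < 2 * K + 2 + p i := by omega
    simp only [Function.comp_apply, h4, if_true]
    exact h2 _ (by omega) (by omega)
  · have h4 : ¬ x < 2 * K + 2 + p i := by omega
    simp only [Function.comp_apply, h4, if_false]
    exact h3 _ (by omega) (by omega)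

/-- Compactness upgrades finite high runs to an infinite one. To have `q` high positions right after
a low run of length `m`, one takes the stage for `m + q` and deletes `q` low positions. -/
theorem Stage.exists_low_high {r s : ℝ} {θ : ℕ → ℝ} {j : ℕ → ℕ} {K : ℕ} (hV : IsCompact V)
    (hsub : ∀ w ∈ V, ∀ t : ℕ → ℕ, StrictMono t → w ∘ t ∈ V) (h : Stage V r s θ j K) (m : ℕ) :
    ∃ w ∈ V, HasDrops r θ j K w ∧ (∀ x, 2 * K ≤ x → x < 2 * K + m → w x ≤ level r θ j K) ∧
      ∀ x, 2 * K + m ≤ x → s ≤ w x := by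
  obtain ⟨w, hwV, hw⟩ := exists_mem_forall_of_isCompact hV
    (fun x => {w : ℕ → ℝ | HasDrops r θ j K w} ∩
      ({w : ℕ → ℝ | 2 * K ≤ x → x < 2 * K + m → w x ≤ level r θ j K} ∩
      {w : ℕ → ℝ | 2 * K + m ≤ x → s ≤ w x}))
    (fun x => (isClosed_hasDrops r θ j K).inter (by
      refine IsClosed.inter ?_ ?_
      · simp only [Set.ofPred_forall]
        exact isClosed_iInter fun _ => isClosed_iInter fun _ =>
          isClosed_le (by fun_prop) (by fun_prop)
      · simp only [Set.ofPred_forall]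
        exact isClosed_iInter fun _ => isClosed_le (by fun_prop) (by fun_prop))) (by
    intro q
    obtain ⟨w, hwV, h1, h2, h3⟩ := h (m + q)
    refine ⟨w ∘ fun x => if x < 2 * K + m then x else x + q, hsub w hwV _ ?_,
      fun x hx => ⟨fun k hk => ?_, fun hx1 hx2 => ?_, fun hx1 => ?_⟩⟩
    · intro x y hxy
      simp only
      split_ifs <;> omega
    · have h4 : 2 * k < 2 * K + m := by omega
      have h5 : 2 * k + 1 < 2 * K + m := by omega
      simp only [Function.comp_apply, h4, h5, if_true]
      exact h1 k hk
    · simp only [Function.comp_apply, hx2, if_true]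
      exact h2 _ hx1 (by omega)
    · have h4 : ¬ x < 2 * K + m := by omega
      simp only [Function.comp_apply, h4, if_false]
      exact h3 _ (by omega) (by omega))
  exact ⟨w, hwV, (hw 0).1, fun x => (hw x).2.1, fun x => (hw x).2.2⟩

/-- The average of the ramps that increase from `0` to `1` on the bands
`[ρ + θ (i + 1), ρ + θ i]`, for `i < J`. -/
noncomputable def rampAvg (J : ℕ) (ρ : ℝ) (θ : ℕ → ℝ) (x : ℝ) : ℝ :=
  (∑ i ∈ Finset.range J, max 0 (min 1 ((x - ρ - θ (i + 1)) / (θ i - θ (i + 1))))) / J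

theorem continuous_rampAvg (J : ℕ) (ρ : ℝ) (θ : ℕ → ℝ) : Continuous (rampAvg J ρ θ) := by
  unfold rampAvg
  fun_prop

theorem rampAvg_mem_Icc (J : ℕ) (ρ : ℝ) (θ : ℕ → ℝ) (x : ℝ) :
    rampAvg J ρ θ x ∈ Set.Icc (0 : ℝ) 1 := by
  unfold rampAvg
  refine ⟨div_nonneg (Finset.sum_nonneg fun i _ => le_max_left _ _) (Nat.cast_nonneg J), ?_⟩
  refine div_le_one_of_le₀ ?_ (Nat.cast_nonneg J)
  refine (Finset.sum_le_sum fun i _ => max_le zero_le_one (min_le_left _ _)).trans ?_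
  simp

section Ramp

variable {J : ℕ} {ρ : ℝ} {θ : ℕ → ℝ}

theorem rampAvg_eq_zero (hθ : StrictAnti θ) (hpos : ∀ i, 0 < θ i) {x : ℝ} (hx : x ≤ ρ) : rampAvg J ρ θ x = 0 := by
  unfold rampAvg
  rw [Finset.sum_eq_zero, zero_div]
  intro i _
  refine max_eq_left ((min_le_right _ _).trans ?_)
  exact div_nonpos_of_nonpos_of_nonneg (by linarith [hpos (i + 1)])
    (sub_nonneg.2 (hθ (Nat.lt_succ_self i)).le)

theorem rampAvg_eq_one (hθ : StrictAnti θ) (hJ : 0 < J) {x : ℝ} (hx : ρ + θ 0 ≤ x) : rampAvg J ρ θ x = 1 := by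
  unfold rampAvg
  have hJ' : (0 : ℝ) < J := by exact_mod_cast hJ
  rw [Finset.sum_congr rfl (g := fun _ => (1 : ℝ)), Finset.sum_const, Finset.card_range,
    nsmul_eq_mul, mul_one, div_self hJ'.ne']
  intro i _
  have h1 := hθ (Nat.lt_succ_self i)
  have h2 := hθ.antitone (Nat.zero_le i)
  rw [min_eq_left, max_eq_right zero_le_one]
  rw [one_le_div (sub_pos.2 h1)]
  linarith

/-- If `x` and `y` are not on different sides of a band, then the value drops by at most `2 / J`
from `x` to `y`. -/
theorem rampAvg_sub_le (hθ : StrictAnti θ) {x y : ℝ}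
    (h : ∀ i < J, ρ + θ i ≤ x → ¬ y ≤ ρ + θ (i + 1)) :
    rampAvg J ρ θ x - rampAvg J ρ θ y ≤ 2 / J := by
  let g : ℕ → ℝ → ℝ := fun i z => max 0 (min 1 ((z - ρ - θ (i + 1)) / (θ i - θ (i + 1))))
  have hg0 : ∀ i z, 0 ≤ g i z := fun i z => le_max_left _ _
  have hg1 : ∀ i z, g i z ≤ 1 := fun i z => max_le zero_le_one (min_le_left _ _)
  let T : Finset ℕ := (Finset.range J).filter fun i => g i y < g i x
  have hT : ∀ i ∈ T, i < J ∧ ρ + θ (i + 1) < x ∧ y < ρ + θ i := by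
    intro i hi
    obtain ⟨hi, hlt⟩ := Finset.mem_filter.1 hi
    have h1 := hθ (Nat.lt_succ_self i)
    refine ⟨Finset.mem_range.1 hi, ?_, ?_⟩
    · by_contra! hx
      have : g i x = 0 := max_eq_left ((min_le_right _ _).trans
        (div_nonpos_of_nonpos_of_nonneg (by linarith) (sub_nonneg.2 h1.le)))
      linarith [hg0 i y]
    · by_contra! hy
      have : g i y = 1 := by
        simp only [g]
        rw [min_eq_left, max_eq_right zero_le_one]
        rw [one_le_div (sub_pos.2 h1)]
        linarith
      linarith [hg1 i x]
  have hcard : T.card ≤ 2 := by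
    rcases T.eq_empty_or_nonempty with h0 | h0
    · simp [h0]
    · have hsub : T ⊆ {T.min' h0, T.min' h0 + 1} := by
        intro i hi
        have h1 := T.min'_le i hi
        by_contra hne
        simp only [Finset.mem_insert, Finset.mem_singleton, not_or] at hne
        have h2 : T.min' h0 + 2 ≤ i := by omega
        obtain ⟨-, hx, -⟩ := hT _ (T.min'_mem h0)
        obtain ⟨hiJ, -, hy⟩ := hT i hi
        have h3 := hθ.antitone h2
        exact h (T.min' h0 + 1) (by omega) hx.le (by linarith)
      exact (Finset.card_le_card hsub).trans Finset.card_le_two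
  have hsum : ∑ i ∈ Finset.range J, (g i x - g i y) ≤ 2 := by
    have h1 : ∑ i ∈ Finset.range J, (g i x - g i y) ≤
        ∑ i ∈ Finset.range J, if g i y < g i x then (1 : ℝ) else 0 := by
      refine Finset.sum_le_sum fun i _ => ?_
      split_ifs with hi
      · linarith [hg0 i y, hg1 i x]
      · linarith
    rw [← Finset.sum_filter, Finset.sum_const, nsmul_eq_mul, mul_one] at h1
    exact h1.trans (by exact_mod_cast hcard)
  have : rampAvg J ρ θ x - rampAvg J ρ θ y = (∑ i ∈ Finset.range J, (g i x - g i y)) / J := by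
    rw [Finset.sum_sub_distrib, sub_div]
    rfl
  rw [this]
  gcongr

end Ramp

/-- The `q`-th block of length `M` of a sequence. -/
def block (M : ℕ) (w : ℕ → ℝ) (q : ℕ) : ℕ → ℝ := fun l => w (q * M + l)

/-- The amount by which the prescribed drops in `x` and the lower bound `s` for the first `M`
entries of `z` are violated. -/
noncomputable def defect (r s : ℝ) (θ : ℕ → ℝ) (j : ℕ → ℕ) (K M : ℕ) (x z : ℕ → ℝ) : ℝ :=
  ∑ k ∈ Finset.range K, (max 0 (level r θ j k + θ (j k) - x (2 * k)) +
    max 0 (x (2 * k + 1) - level r θ j (k + 1))) + ∑ l ∈ Finset.range M, max 0 (s - z l)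

theorem defect_nonneg (r s : ℝ) (θ : ℕ → ℝ) (j : ℕ → ℕ) (K M : ℕ) (x z : ℕ → ℝ) :
    0 ≤ defect r s θ j K M x z :=
  add_nonneg (Finset.sum_nonneg fun _ _ => add_nonneg (le_max_left _ _) (le_max_left _ _))
    (Finset.sum_nonneg fun _ _ => le_max_left _ _)

theorem defect_eq_zero_iff {r s : ℝ} {θ : ℕ → ℝ} {j : ℕ → ℕ} {K M : ℕ} {x z : ℕ → ℝ} :
    defect r s θ j K M x z = 0 ↔ HasDrops r θ j K x ∧ ∀ l < M, s ≤ z l := by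
  unfold defect HasDrops
  rw [add_eq_zero_iff_of_nonneg (Finset.sum_nonneg fun _ _ =>
      add_nonneg (le_max_left _ _) (le_max_left _ _)) (Finset.sum_nonneg fun _ _ =>
      le_max_left _ _), Finset.sum_eq_zero_iff_of_nonneg fun _ _ =>
      add_nonneg (le_max_left _ _) (le_max_left _ _),
    Finset.sum_eq_zero_iff_of_nonneg fun _ _ => le_max_left _ _]
  refine and_congr (forall_congr' fun k => ?_) (forall_congr' fun l => ?_)
  · rw [Finset.mem_range, add_eq_zero_iff_of_nonneg (le_max_left _ _) (le_max_left _ _),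
      max_eq_left_iff, max_eq_left_iff, sub_nonpos, sub_nonpos]
  · rw [Finset.mem_range, max_eq_left_iff, sub_nonpos]

end SequenceSpaces

/-! ### The almost monotone connective -/

section Connective

variable {V : Set (ℕ → ℝ)}

theorem continuous_defect (r s : ℝ) (θ : ℕ → ℝ) (j : ℕ → ℕ) (K M : ℕ) :
    Continuous fun x : (ℕ → ℝ) × (ℕ → ℝ) => defect r s θ j K M x.1 x.2 := by
  unfold defect
  fun_prop

theorem continuous_block (M q : ℕ) : Continuous fun w : ℕ → ℝ => block M w q :=
  continuous_pi fun l => continuous_apply (q * M + l)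

/-- A connective in three blocks of `M` variables that is almost nondecreasing when the middle
block moves to the right in a sequence from `V`, while it jumps from `0` to `1` along suitable
sequences from `V`. -/
theorem exists_connective (hV : IsCompact V)
    (hsub : ∀ w ∈ V, ∀ t : ℕ → ℕ, StrictMono t → w ∘ t ∈ V)
    (hconv : ∀ w ∈ V, ∃ l, Tendsto w atTop (𝓝 l)) {r s : ℝ} (hrs : r < s)
    (hlh : ∀ p : ℕ, ∃ v ∈ V, (∀ i < p, v i ≤ r) ∧ ∀ i, p ≤ i → s ≤ v i) {J : ℕ} (hJ : 0 < J) :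
    ∃ (M : ℕ) (c : (ℕ → ℝ) → (ℕ → ℝ) → (ℕ → ℝ) → ℝ),
      (Continuous fun x : (ℕ → ℝ) × (ℕ → ℝ) × (ℕ → ℝ) => c x.1 x.2.1 x.2.2) ∧
      (∀ x y z, c x y z ∈ Set.Icc (0 : ℝ) 1) ∧
      (∀ x x' y y' z z', (∀ l < M, x l = x' l) → (∀ l < M, y l = y' l) →
        (∀ l < M, z l = z' l) → c x y z = c x' y' z') ∧
      (∀ w ∈ V, c (block M w 0) (block M w 1) (block M w 3) -
        c (block M w 0) (block M w 2) (block M w 3) ≤ 2 / J) ∧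
      ∀ p : ℕ, ∃ w ∈ V, ∃ l : ℝ, Tendsto w atTop (𝓝 l) ∧
        (∀ i < p, c (block M w 0) (block M w (i + 1)) (fun _ => l) = 0) ∧
        ∀ i, p ≤ i → c (block M w 0) (block M w (i + 1)) (fun _ => l) = 1 := by
  obtain ⟨θ, j, K, P, hpos, hhalf, hlevel, hst, hmax⟩ :=
    exists_maximal_stage hV hsub hconv hrs hlh hJ
  have hθ : StrictAnti θ := strictAnti_nat_of_succ_lt fun i => by
    linarith [hpos i, hhalf i]
  let ρ := level r θ j K
  -- A block has room for the `2K` positions of the drops and for a run of length `P`; the `1` makes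
  -- it nonempty.
  let M := 2 * K + P + 1
  have hM : (Finset.range M).Nonempty := ⟨0, by simp [M]⟩
  let D : (ℕ → ℝ) → (ℕ → ℝ) → ℝ := defect r s θ j K M
  -- The bad sequences: some value in block 1 is above a band and all of block 2 is below it.
  let E : Set (ℕ → ℝ) := V ∩ ⋃ i ∈ Finset.range J, ⋃ l ∈ Finset.range M,
    ({w : ℕ → ℝ | ρ + θ i ≤ w (M + l)} ∩
      ⋂ l' ∈ Finset.range M, {w : ℕ → ℝ | w (2 * M + l') ≤ ρ + θ (i + 1)})
  have hE : IsCompact E := by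
    refine hV.inter_right ?_
    refine isClosed_biUnion_finset fun i _ => isClosed_biUnion_finset fun l _ => ?_
    exact (isClosed_le (by fun_prop) (by fun_prop)).inter
      (isClosed_biInter fun l' _ => isClosed_le (by fun_prop) (by fun_prop))
  have hDcont : Continuous fun w : ℕ → ℝ => D (block M w 0) (block M w 3) :=
    (continuous_defect r s θ j K M).comp ((continuous_block M 0).prodMk (continuous_block M 3))
  have hDpos : ∀ w ∈ E, 0 < D (block M w 0) (block M w 3) := by
    rintro w ⟨hwV, hw⟩
    refine lt_of_le_of_ne (defect_nonneg _ _ _ _ _ _ _ _) fun h0 => ?_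
    obtain ⟨hd, hz⟩ := defect_eq_zero_iff.1 h0.symm
    simp only [Set.mem_iUnion, Set.mem_inter_iff, Set.mem_iInter, Finset.mem_range,
      Set.mem_ofPred_eq, exists_prop] at hw
    obtain ⟨i, hi, l₀, hl₀, h1, h2⟩ := hw
    -- With zero defect, the initial drops, the high entry of block 1, the start of block 2 and the
    -- start of block 3 form a subsequence that violates maximality.
    refine hmax i hi (w ∘ fun x => if x < 2 * K then x else if x = 2 * K then M + l₀ else
      if x ≤ 2 * K + P then 2 * M + (x - (2 * K + 1)) else 3 * M + (x - (2 * K + P + 1)))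
      (hsub w hwV _ ?_) (fun k hk => ?_) ?_ (fun x hx hx' => ?_) (fun x hx hx' => ?_)
    · intro x y hxy
      simp only
      split_ifs <;> omega
    · have h4 : 2 * k < 2 * K := by omega
      have h5 : 2 * k + 1 < 2 * K := by omega
      simp only [Function.comp_apply, h4, h5, if_true]
      have := hd k hk
      simpa only [block, zero_mul, zero_add] using this
    · simp only [Function.comp_apply, lt_irrefl, if_false, if_true]
      exact h1
    · have h4 : ¬ x < 2 * K := by omega
      have h5 : ¬ x = 2 * K := by omega
      simp only [Function.comp_apply, h4, h5, hx', if_false, if_true]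
      exact h2 _ (by omega)
    · have h4 : ¬ x < 2 * K := by omega
      have h5 : ¬ x = 2 * K := by omega
      have h6 : ¬ x ≤ 2 * K + P := by omega
      simp only [Function.comp_apply, h4, h5, h6, if_false]
      exact hz (x - (2 * K + P + 1)) (by omega)
  obtain ⟨τ, hτ, hτE⟩ : ∃ τ > 0, ∀ w ∈ E, τ ≤ D (block M w 0) (block M w 3) := by
    rcases E.eq_empty_or_nonempty with h0 | h0
    · exact ⟨1, one_pos, by simp [h0]⟩
    · obtain ⟨w, hw, hmin⟩ := hE.exists_isMinOn h0 hDcont.continuousOn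
      exact ⟨_, hDpos w hw, fun w' hw' => hmin hw'⟩
  -- The cutoff `g` is `1` at zero defect and `0` once the defect reaches `τ`, in particular on `E`.
  let g : (ℕ → ℝ) → (ℕ → ℝ) → ℝ := fun x z => max 0 (1 - D x z / τ)
  let f : (ℕ → ℝ) → ℝ := fun y => rampAvg J ρ θ ((Finset.range M).sup' hM y)
  have hg : ∀ x z, g x z ∈ Set.Icc (0 : ℝ) 1 := fun x z =>
    ⟨le_max_left _ _, max_le zero_le_one
      (sub_le_self _ (div_nonneg (defect_nonneg _ _ _ _ _ _ _ _) hτ.le))⟩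
  have hf : ∀ y, f y ∈ Set.Icc (0 : ℝ) 1 := fun y => rampAvg_mem_Icc _ _ _ _
  refine ⟨M, fun x y z => g x z * f y, ?_, fun x y z => ?_, ?_, ?_, ?_⟩
  · refine Continuous.mul ?_ ?_
    · have h1 : Continuous fun x : (ℕ → ℝ) × (ℕ → ℝ) × (ℕ → ℝ) => D x.1 x.2.2 :=
        (continuous_defect r s θ j K M).comp (continuous_fst.prodMk continuous_snd.snd)
      exact continuous_const.max (continuous_const.sub (h1.div_const τ))
    · refine (continuous_rampAvg J ρ θ).comp ?_
      exact Continuous.finset_sup'_apply hM fun i _ => by fun_prop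
  · exact ⟨mul_nonneg (hg x z).1 (hf y).1, mul_le_one₀ (hg x z).2 (hf y).1 (hf y).2⟩
  · intro x x' y y' z z' hx hy hz
    have h1 : D x z = D x' z' := by
      simp only [D, defect]
      congr 1
      · refine Finset.sum_congr rfl fun k hk => ?_
        rw [Finset.mem_range] at hk
        rw [hx (2 * k) (by omega), hx (2 * k + 1) (by omega)]
      · refine Finset.sum_congr rfl fun l hl => ?_
        rw [hz l (Finset.mem_range.1 hl)]
    have h2 : f y = f y' := by
      simp only [f]
      rw [Finset.sup'_congr hM rfl fun l hl => hy l (Finset.mem_range.1 hl)]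
    simp only [g, h1, h2]
  · intro w hwV
    rw [← mul_sub]
    have hJ0 : (0 : ℝ) ≤ 2 / J := by positivity
    by_cases hw : w ∈ E
    · have h1 : g (block M w 0) (block M w 3) = 0 := by
        refine max_eq_left (sub_nonpos.2 ?_)
        rw [one_le_div hτ]
        exact hτE w hw
      rw [h1, zero_mul]
      exact hJ0
    · have h1 : f (block M w 1) - f (block M w 2) ≤ 2 / J := by
        refine rampAvg_sub_le hθ fun i hi hx hy => hw ⟨hwV, ?_⟩
        simp only [Set.mem_iUnion, Set.mem_inter_iff, Set.mem_iInter, Finset.mem_range,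
          Set.mem_ofPred_eq, exists_prop]
        obtain ⟨l, hl, hlx⟩ := (Finset.le_sup'_iff hM).1 hx
        refine ⟨i, hi, l, Finset.mem_range.1 hl, ?_, fun l' hl' => ?_⟩
        · simpa only [block, one_mul] using hlx
        · exact (Finset.sup'_le_iff hM _).1 hy l' (Finset.mem_range.2 hl')
      obtain ⟨h2, h3⟩ := hg (block M w 0) (block M w 3)
      nlinarith
  · intro p
    -- With this length the high part starts exactly at `(p + 1) * M`: blocks `1, …, p` are low and
    -- all later ones are high.
    obtain ⟨w, hwV, hd, hlow, hhigh⟩ := hst.exists_low_high hV hsub ((p + 1) * M - 2 * K)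
    obtain ⟨l, hl⟩ := hconv w hwV
    have hMp : M ≤ (p + 1) * M := Nat.le_mul_of_pos_left M (Nat.succ_pos p)
    have hKM : 2 * K + ((p + 1) * M - 2 * K) = (p + 1) * M := by omega
    rw [hKM] at hlow hhigh
    have hsl : s ≤ l := ge_of_tendsto hl
      ((eventually_ge_atTop ((p + 1) * M)).mono fun x hx => hhigh x hx)
    have hD0 : D (block M w 0) (fun _ => l) = 0 := by
      refine defect_eq_zero_iff.2 ⟨fun k hk => ?_, fun _ _ => hsl⟩
      simpa only [block, zero_mul, zero_add] using hd k hk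
    have hg1 : g (block M w 0) (fun _ => l) = 1 := by
      simp only [g, hD0, zero_div, sub_zero]
      exact max_eq_right zero_le_one
    refine ⟨w, hwV, l, hl, fun i hi => ?_, fun i hi => ?_⟩
    · have h1 : f (block M w (i + 1)) = 0 := by
        refine rampAvg_eq_zero hθ hpos ((Finset.sup'_le_iff hM _).2 fun x hx => ?_)
        rw [Finset.mem_range] at hx
        have h2 : (i + 1 + 1) * M ≤ (p + 1) * M := Nat.mul_le_mul_right M (by omega)
        have h3 : (i + 1 + 1) * M = (i + 1) * M + M := Nat.succ_mul _ _
        have h4 : M ≤ (i + 1) * M := Nat.le_mul_of_pos_left M (Nat.succ_pos i)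
        exact hlow _ (by omega) (by omega)
      simp only [h1, mul_zero]
    · have h1 : f (block M w (i + 1)) = 1 := by
        refine rampAvg_eq_one hθ hJ ?_
        have h2 : (p + 1) * M ≤ (i + 1) * M := Nat.mul_le_mul_right M (by omega)
        refine hlevel.trans ((hhigh ((i + 1) * M + 0) (by omega)).trans ?_)
        exact Finset.le_sup' (block M w (i + 1)) (Finset.mem_range.2 (by omega))
      simp only [h1, hg1, mul_one]

end Connective

/-! ### From NSCP to wSOP -/

section Transfer

variable {L : ContLanguage.{u, v}} {U : Type w} [MetricSpace U] [ContStructure L U]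

theorem IsSaturated.realize_seq {κ : Cardinal.{w}} (hκ : Cardinal.aleph0 < κ)
    (hU : IsSaturated L U κ) {k m : ℕ} (φ : Formula L (Fin k ⊕ Fin m)) (a : ℕ → Fin m → U)
    (x : ℕ → unitInterval)
    (h : ∀ F : Finset ℕ, ∀ ε > 0, ∃ d : Fin k → U, ∀ i ∈ F,
      dist (φ.val (Sum.elim d (a i))) (x i) < ε) :
    ∃ d : Fin k → U, ∀ i, φ.val (Sum.elim d (a i)) = x i := by
  have hg : ∀ (i : ℕ) (d : Fin k → U), (φ.rename (Sum.map id fun y => (i, y))).val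
      (Sum.elim d fun p : ℕ × Fin m => a p.1 p.2) = φ.val (Sum.elim d (a i)) := by
    intro i d
    rw [val_rename, Sum.elim_comp_map, Function.comp_id]
    rfl
  obtain ⟨d, hd⟩ := hU.realize_of_approx hκ (fun p : ℕ × Fin m => a p.1 p.2)
    (fun i => φ.rename (Sum.map id fun y => (i, y))) x (by simpa only [hg] using h)
  exact ⟨d, fun i => by rw [← hd i, hg]⟩

/-- The sequences of values `φ(d, a_i)`. -/
def valueSeqs {k m : ℕ} (φ : Formula L (Fin k ⊕ Fin m)) (a : ℕ → Fin m → U) : Set (ℕ → ℝ) :=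
  Set.range fun (d : Fin k → U) (i : ℕ) => φ.val₂ d (a i)

/-- By saturation, a pointwise limit of value sequences is again the value sequence of a tuple, so
these form a closed subset of `[0,1]^ℕ`. -/
theorem IsSaturated.isCompact_valueSeqs {κ : Cardinal.{w}} (hκ : Cardinal.aleph0 < κ)
    (hU : IsSaturated L U κ) {k m : ℕ} (φ : Formula L (Fin k ⊕ Fin m)) (a : ℕ → Fin m → U) :
    IsCompact (valueSeqs φ a) := by
  have h1 : IsClosed (Set.range fun (d : Fin k → U) (i : ℕ) => φ.val (Sum.elim d (a i))) := by
    refine isClosed_of_closure_subset fun x hx => ?_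
    obtain ⟨d, hd⟩ := hU.realize_seq hκ φ a x (by
      intro F ε hε
      obtain ⟨_, ⟨d, rfl⟩, hd⟩ := exists_dist_lt_of_mem_closure hx F hε
      exact ⟨d, hd⟩)
    exact ⟨d, funext hd⟩
  have h2 := h1.isCompact.image (f := fun (x : ℕ → unitInterval) (i : ℕ) => (x i : ℝ))
    (by fun_prop)
  rw [← Set.range_comp] at h2
  exact h2

/-- The tuple `d` takes the required values at the positions `t i`; indiscernibility moves them to
the positions `i`, at the price of changing `d`. -/
theorem IsSaturated.comp_mem_valueSeqs {κ : Cardinal.{w}} (hκ : Cardinal.aleph0 < κ)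
    (hU : IsSaturated L U κ) {k m : ℕ} {φ : Formula L (Fin k ⊕ Fin m)} {a : ℕ → Fin m → U}
    (ha : OrderIndiscernible L a) {x : ℕ → ℝ} (hx : x ∈ valueSeqs φ a) {t : ℕ → ℕ}
    (ht : StrictMono t) : x ∘ t ∈ valueSeqs φ a := by
  obtain ⟨d, rfl⟩ := hx
  obtain ⟨d', hd'⟩ := ha.realize_of_approx hκ hU (fun _ : ℕ => φ) (fun i => i)
    (fun i => φ.val (Sum.elim d (a (t i)))) (fun F ε hε =>
      ⟨t, d, fun q _ q' _ => ht.lt_iff_lt.symm, fun q _ => by rwa [dist_self]⟩)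
  exact ⟨d', funext fun i => congrArg Subtype.val (hd' i)⟩

theorem mul_add_lt_mul_add_iff {M a b l l' : ℕ} (hl : l < M) (hl' : l' < M) :
    a * M + l < b * M + l' ↔ a < b ∨ a = b ∧ l < l' := by
  rcases lt_trichotomy a b with h | rfl | h
  · have h1 : (a + 1) * M ≤ b * M := Nat.mul_le_mul_right M h
    rw [Nat.succ_mul] at h1
    exact ⟨fun _ => Or.inl h, fun _ => by omega⟩
  · simp
  · have h1 : (b + 1) * M ≤ a * M := Nat.mul_le_mul_right M h
    rw [Nat.succ_mul] at h1
    constructor <;> intro h2 <;> omega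

theorem OrderIndiscernible.blocks {ι : Type} [Finite ι] {a : ℕ → ι → U}
    (ha : OrderIndiscernible L a) (M : ℕ) :
    OrderIndiscernible L fun (i : ℕ) (p : Fin M × ι) => a (i * M + p.1) p.2 := by
  intro n χ s t hs ht
  exact ha.val_eq χ (fun q => s q.1 * M + q.2.1) (fun q => t q.1 * M + q.2.1) (fun q => q.2.2)
    fun q q' => by
      rw [mul_add_lt_mul_add_iff q.2.1.2 q'.2.1.2, mul_add_lt_mul_add_iff q.2.1.2 q'.2.1.2,
        hs.lt_iff_lt, ht.lt_iff_lt, hs.injective.eq_iff, ht.injective.eq_iff]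

/-- Lets a natural number beyond all the finite positions involved play the part of `⊤`. -/
theorem lt_iff_untopD_lt {o o' : WithTop ℕ} {N : ℕ} (h : ∀ i : ℕ, o = i → i < N)
    (h' : ∀ i : ℕ, o' = i → i < N) : o < o' ↔ o.untopD N < o'.untopD N := by
  induction o using WithTop.recTopCoe with
  | top =>
    induction o' using WithTop.recTopCoe with
    | top => simp
    | coe j => exact iff_of_false not_top_lt (h' j rfl).not_gt
  | coe i =>
    induction o' using WithTop.recTopCoe with
    | top => exact iff_of_true (WithTop.coe_lt_top i) (h i rfl)
    | coe j => exact WithTop.coe_lt_coe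

/-- The positions of the three blocks of the `i`-th tuple. -/
def position (i : ℕ) : Fin 3 → WithTop ℕ := ![((0 : ℕ) : WithTop ℕ), ((i + 1 : ℕ) : WithTop ℕ), ⊤]

theorem position_lt_iff {i j i' j' : ℕ} (h : i < j ↔ i' < j')
    (x y : Fin 3) : position i x < position j y ↔ position i' x < position j' y := by
  fin_cases x <;> fin_cases y <;> simp [position, -Nat.cast_add, -Nat.cast_one, h, -WithTop.coe_add]

theorem FormulaHasNSCP.hasWSOP {κ : Cardinal.{w}} (hκ : Cardinal.aleph0 < κ)
    (hU : IsSaturated L U κ) {k m : ℕ} {φ : Formula L (Fin k ⊕ Fin m)}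
    (h : FormulaHasNSCP U φ) : HasWSOP L U := by
  obtain ⟨a, b, ε, hε, ha, hconv, hlt⟩ := h
  have ha' : OrderIndiscernible L a := ha
  let V := valueSeqs φ a
  have hV : IsCompact V := hU.isCompact_valueSeqs hκ φ a
  have hsub : ∀ x ∈ V, ∀ t : ℕ → ℕ, StrictMono t → x ∘ t ∈ V := fun x hx t ht =>
    hU.comp_mem_valueSeqs hκ ha' hx ht
  have hVconv : ∀ x ∈ V, ∃ l, Tendsto x atTop (𝓝 l) := by
    rintro _ ⟨d, rfl⟩
    exact hconv d
  obtain ⟨r, s, hrs, hlh⟩ := exists_low_high hV hsub hVconv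
    (fun j i => φ.val₂ (b j) (a i)) (fun j => ⟨b j, rfl⟩) hε hlt
  -- The jump from `0` to `1` exceeds `1 / 2`, and `J = 4n` makes the admissible fall `2 / J` equal
  -- to `(1 / 2) / n`.
  refine ⟨k, m, φ, 1 / 2, one_half_pos, fun n hn => ?_⟩
  obtain ⟨M, c, hc, hc01, hcongr, hdrop, hjump⟩ :=
    exists_connective hV hsub hVconv hrs hlh (J := 4 * n) (by omega)
  obtain ⟨A, hA, hAa⟩ := exists_orderIndiscernible_withTop hκ hU (ha'.blocks M)
  let φ' : Fin M → Formula L (Fin k ⊕ (Fin M × Fin m)) := fun l =>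
    φ.rename (Sum.map id fun x => (l, x))
  have hφ' : ∀ l d (y : Fin M × Fin m → U), (φ' l).val (Sum.elim d y) =
      φ.val (Sum.elim d fun x => y (l, x)) := by
    intro l d y
    rw [val_rename, Sum.elim_comp_map, Function.comp_id]
    rfl
  have hAn : ∀ (i : ℕ) (l : Fin M) (d : Fin k → U),
      (φ' l).val (Sum.elim d (A i)) = φ.val (Sum.elim d (a (i * M + l))) := by
    intro i l d
    rw [hφ', hAa]
  -- The value `0` beyond `M` is immaterial: `c` depends only on the first `M` entries of each
  -- block.
  let B : (Fin k → U) → WithTop ℕ → ℕ → ℝ := fun d o l =>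
    if h : l < M then (((φ' ⟨l, h⟩).val (Sum.elim d (A o)) : unitInterval) : ℝ) else 0
  let slot : Fin 3 → (Fin (3 * M) → unitInterval) → ℕ → ℝ := fun x t l =>
    if h : l < M then (t (finProdFinEquiv (x, ⟨l, h⟩)) : ℝ) else 0
  have hslot : ∀ x, Continuous (slot x) := by
    intro x
    refine continuous_pi fun l => ?_
    simp only [slot]
    split_ifs <;> fun_prop
  let c' : C(Fin (3 * M) → unitInterval, unitInterval) :=
    ⟨fun t => ⟨c (slot 0 t) (slot 1 t) (slot 2 t), hc01 _ _ _⟩,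
      Continuous.subtype_mk (hc.comp ((hslot 0).prodMk ((hslot 1).prodMk (hslot 2)))) _⟩
  let T : ℕ → Fin (3 * M) × Fin m → U := fun i q =>
    A (position i (finProdFinEquiv.symm q.1).1) ((finProdFinEquiv.symm q.1).2, q.2)
  have hval : ∀ d i, (combination φ c').val₂ d (T i) =
      c (B d (0 : ℕ)) (B d (i + 1 : ℕ)) (B d ⊤) := by
    intro d i
    have h1 : (combination φ c').val₂ d (T i) = ((c' fun j =>
        (φ.relabel (Sum.map id fun x => (j, x))).realize (Sum.elim d (T i)) Fin.elim0 :
          unitInterval) : ℝ) := rfl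
    have h2 : ∀ x : Fin 3, slot x (fun j =>
        (φ.relabel (Sum.map id fun x => (j, x))).realize (Sum.elim d (T i)) Fin.elim0) =
        B d (position i x) := by
      intro x
      funext l
      simp only [slot, B]
      split_ifs with hl
      · rw [realize_relabel, Sum.elim_comp_map, Function.comp_id, hφ']
        congr 3
        funext y
        simp only [T, Function.comp_apply, Equiv.symm_apply_apply]
      · rfl
    rw [h1]
    simp only [c', ContinuousMap.coe_mk, h2]
    rfl
  refine ⟨3 * M, c', T, ?_⟩
  have hb : ∀ p : ℕ, ∃ d : Fin k → U,
      (∀ i < p, c (B d (0 : ℕ)) (B d (i + 1 : ℕ)) (B d ⊤) = 0) ∧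
      ∀ i, p ≤ i → c (B d (0 : ℕ)) (B d (i + 1 : ℕ)) (B d ⊤) = 1 := by
    intro p
    obtain ⟨_, ⟨d₀, rfl⟩, l, hl, h0, h1⟩ := hjump p
    have hl01 : l ∈ Set.Icc (0 : ℝ) 1 :=
      isClosed_Icc.mem_of_tendsto hl (Filter.Eventually.of_forall fun i =>
        (φ.val (Sum.elim d₀ (a i))).2)
    let W : WithTop ℕ × Fin M → unitInterval := fun q =>
      WithTop.recTopCoe ⟨l, hl01⟩ (fun i => φ.val (Sum.elim d₀ (a (i * M + q.2)))) q.1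
    -- A tuple with the values of `d₀` on all finite blocks and the limit `l` throughout the block
    -- at `⊤`.
    obtain ⟨d, hd⟩ := hA.realize_of_approx hκ hU (fun q : WithTop ℕ × Fin M => φ' q.2)
      (fun q => q.1) W (by
      intro F ε hε
      obtain ⟨N₁, hN₁⟩ := Metric.tendsto_atTop.1 hl ε hε
      obtain ⟨N₂, hN₂⟩ : ∃ N₂ : ℕ, ∀ q ∈ F, ∀ i : ℕ, q.1 = i → i < N₂ := by
        refine ⟨F.sup (fun q => WithTop.recTopCoe 0 (fun i => i) q.1) + 1, fun q hq i hi => ?_⟩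
        have := Finset.le_sup (f := fun q : WithTop ℕ × Fin M =>
          (WithTop.recTopCoe 0 (fun i => i) q.1 : ℕ)) hq
        simp only [hi] at this
        exact Nat.lt_succ_of_le this
      -- A late finite block replaces `⊤`: the values of `d₀` there are within `ε` of `l`.
      refine ⟨fun q => (q.1.untopD (max N₁ N₂) : ℕ), d₀, fun q hq q' hq' => ?_, fun q hq => ?_⟩
      · change q.1 < q'.1 ↔ ((q.1.untopD (max N₁ N₂) : ℕ) : WithTop ℕ) <
          ((q'.1.untopD (max N₁ N₂) : ℕ) : WithTop ℕ)
        rw [Nat.cast_lt]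
        exact lt_iff_untopD_lt
          (fun i hi => (hN₂ q hq i hi).trans_le (le_max_right _ _))
          (fun i hi => (hN₂ q' hq' i hi).trans_le (le_max_right _ _))
      · rw [hAn]
        simp only [W]
        induction q.1 using WithTop.recTopCoe with
        | top =>
          refine hN₁ _ ?_
          have h2 : max N₁ N₂ ≤ max N₁ N₂ * M :=
            Nat.le_mul_of_pos_right _ ((Nat.zero_le _).trans_lt q.2.2)
          exact (le_max_left N₁ N₂).trans (h2.trans (Nat.le_add_right _ _))
        | coe i =>
          exact (dist_self (φ.val (Sum.elim d₀ (a (i * M + q.2))))).trans_lt hε)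
    have hBn : ∀ i : ℕ, ∀ x < M, block M (fun i => φ.val₂ d₀ (a i)) i x = B d (i : ℕ) x := by
      intro i x hx
      simp only [B, hx, dif_pos]
      rw [hd ((i : WithTop ℕ), ⟨x, hx⟩)]
      rfl
    have hBt : ∀ x < M, l = B d ⊤ x := by
      intro x hx
      simp only [B, hx, dif_pos]
      rw [hd (⊤, ⟨x, hx⟩)]
      rfl
    refine ⟨d, fun i hi => ?_, fun i hi => ?_⟩
    · rw [← h0 i hi]
      exact (hcongr _ _ _ _ _ _ (hBn 0) (hBn (i + 1)) hBt).symm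
    · rw [← h1 i hi]
      exact (hcongr _ _ _ _ _ _ (hBn 0) (hBn (i + 1)) hBt).symm
  choose β hβ0 hβ1 using hb
  refine ⟨β, ?_, fun d => ?_, fun i d => ?_, fun i j hij => ?_⟩
  · intro n χ s t hs ht
    exact hA.val_eq χ (fun q => position (s q.1) (finProdFinEquiv.symm q.2.1).1)
      (fun q => position (t q.1) (finProdFinEquiv.symm q.2.1).1)
      (fun q => ((finProdFinEquiv.symm q.2.1).2, q.2.2)) fun q q' =>
        position_lt_iff (by rw [hs.lt_iff_lt, ht.lt_iff_lt]) _ _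
  · simp only [hval]
    obtain ⟨l, hl⟩ := hconv d
    refine ⟨_, (hc.tendsto (B d (0 : ℕ), (fun x => if x < M then l else 0), B d ⊤)).comp
      (tendsto_const_nhds.prodMk_nhds (Tendsto.prodMk_nhds ?_ tendsto_const_nhds))⟩
    refine tendsto_pi_nhds.2 fun x => ?_
    by_cases hx : x < M
    · have h1 : ∀ i : ℕ, B d (i + 1 : ℕ) x = φ.val₂ d (a ((i + 1) * M + x)) := by
        intro i
        simp only [B, hx, dif_pos]
        rw [hAn]
        rfl
      have h2 : Tendsto (fun i : ℕ => B d (i + 1 : ℕ) x) atTop (𝓝 l) := by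
        simp only [h1]
        refine hl.comp (StrictMono.tendsto_atTop fun i j hij => ?_)
        exact Nat.add_lt_add_right (Nat.mul_lt_mul_of_pos_right (by omega)
          ((Nat.zero_le _).trans_lt hx)) _
      simp only [hx, if_true]
      exact h2
    · have h1 : ∀ i : ℕ, B d (i + 1 : ℕ) x = 0 := fun i => dif_neg hx
      have h2 : Tendsto (fun i : ℕ => B d (i + 1 : ℕ) x) atTop (𝓝 0) := by
        simp only [h1]
        exact tendsto_const_nhds
      simp only [hx, if_false]
      exact h2
  · rw [hval, hval]
    let τ : Fin 4 → WithTop ℕ :=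
      ![((0 : ℕ) : WithTop ℕ), ((i + 1 : ℕ) : WithTop ℕ), ((i + 2 : ℕ) : WithTop ℕ), ⊤]
    have hτ : StrictMono τ := by
      rw [Fin.strictMono_iff_lt_succ]
      intro x
      fin_cases x
      · exact WithTop.coe_lt_coe.2 (Nat.succ_pos i)
      · exact WithTop.coe_lt_coe.2 (Nat.lt_succ_self _)
      · exact WithTop.coe_lt_top _
    -- The blocks `0, i + 1, i + 2, ⊤` are ordered like `0, 1, 2, 3`, so some `d'` has on the latter
    -- the values of `d` on the former, and `hdrop` applies to `d'`.
    obtain ⟨d', hd'⟩ := hA.realize_of_approx hκ hU (fun q : Fin 4 × Fin M => φ' q.2)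
      (fun q => ((q.1 : ℕ) : WithTop ℕ)) (fun q => (φ' q.2).val (Sum.elim d (A (τ q.1))))
      (fun F ε hε => ⟨fun q => τ q.1, d, fun q _ q' _ => by
        rw [hτ.lt_iff_lt, Nat.cast_lt, Fin.lt_def], fun q _ => by rwa [dist_self]⟩)
    have hB : ∀ q : Fin 4, ∀ x < M,
        block M (fun i => φ.val₂ d' (a i)) q x = B d (τ q) x := by
      intro q x hx
      simp only [B, hx, dif_pos]
      rw [← hd' (q, ⟨x, hx⟩), hAn]
      rfl
    have h1 := hdrop (fun i => φ.val₂ d' (a i)) ⟨d', rfl⟩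
    have h2 : _ = c (B d (0 : ℕ)) (B d (i + 1 : ℕ)) (B d ⊤) :=
      hcongr _ _ _ _ _ _ (hB 0) (hB 1) (hB 3)
    have h3 : _ = c (B d (0 : ℕ)) (B d (i + 2 : ℕ)) (B d ⊤) :=
      hcongr _ _ _ _ _ _ (hB 0) (hB 2) (hB 3)
    rw [← h2, ← h3]
    refine h1.trans (le_of_eq ?_)
    have : (n : ℝ) ≠ 0 := by positivity
    push_cast
    field_simp
    norm_num
  · rw [hval, hval, hβ0 j i hij, hβ1 i j hij.le]
    norm_num

end Transfer

/-! ### Continuity of limits along indiscernible sequences -/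

section Limits

variable {L : ContLanguage.{u, v}} {U : Type w} [MetricSpace U] [ContStructure L U]

/-- The case `n = 1` suffices; only the variables indexed by `Fin r × Fin m` have to be recoded by
`Fin (r * m)`. -/
theorem HasWSOP.exists_formulaHasNSCP (h : HasWSOP L U) :
    ∃ (k m : ℕ) (φ : Formula L (Fin k ⊕ Fin m)), FormulaHasNSCP U φ := by
  obtain ⟨k, m, φ, ε, hε, h⟩ := h
  obtain ⟨r, c, a, b, ha, hconv, -, hlt⟩ := h 1 le_rfl
  let e : Fin r × Fin m ≃ Fin (r * m) := finProdFinEquiv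
  have hval : ∀ d i, ((combination φ c).rename (Sum.map id e)).val₂ d (a i ∘ e.symm) =
      (combination φ c).val₂ d (a i) := by
    intro d i
    unfold Formula.val₂
    rw [val_rename, Sum.elim_comp_map, Function.comp_id, Function.comp_assoc,
      e.symm_comp_self, Function.comp_id]
  refine ⟨k, r * m, (combination φ c).rename (Sum.map id e), fun i => a i ∘ e.symm, b, ε, hε,
    fun n χ s t hs ht => ?_, fun d => ?_, fun i j hij => ?_⟩
  · have := ha n (χ.rename (Prod.map id e.symm)) s t hs ht
    rw [val_rename, val_rename] at this
    exact this
  · simp only [hval]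
    exact hconv d
  · rw [hval, hval]
    exact hlt i j hij

/-- The `φ`-type over `U` of a tuple in `U`. -/
noncomputable def realizedType {k m : ℕ} (φ : Formula L (Fin k ⊕ Fin m)) (d : Fin k → U) : phiTypes U φ :=
  ⟨fun a => φ.val (Sum.elim d a), subset_closure ⟨d, rfl⟩⟩

/-- Since countably many parameters are involved, convergence at all types reduces to convergence at
tuples of `U`. -/
theorem IsSaturated.exists_realize_phiType {κ : Cardinal.{w}} (hκ : Cardinal.aleph0 < κ)
    (hU : IsSaturated L U κ) {k m : ℕ} {φ : Formula L (Fin k ⊕ Fin m)} (a : ℕ → Fin m → U)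
    (p : phiTypes U φ) : ∃ d : Fin k → U, ∀ i, φ.val (Sum.elim d (a i)) = p.1 (a i) := by
  classical
  refine hU.realize_seq hκ φ a _ fun F ε hε => ?_
  obtain ⟨_, ⟨d, rfl⟩, hd⟩ := exists_dist_lt_of_mem_closure p.2 (F.image a) hε
  exact ⟨d, fun i hi => hd _ (Finset.mem_image_of_mem a hi)⟩

/-- Let `p` be the limit of the types of the `b j` along an ultrafilter. Letting `j` grow in the
pattern gives `p(a i) + ε ≤ f (b i)`; if `f` were continuous, letting `i` grow would give `f p + ε ≤
f p`. -/
theorem FormulaHasNSCP.not_indiscernibleLimitsContinuous {κ : Cardinal.{w}}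
    (hκ : Cardinal.aleph0 < κ) (hU : IsSaturated L U κ) {k m : ℕ}
    {φ : Formula L (Fin k ⊕ Fin m)} (h : FormulaHasNSCP U φ) :
    ¬ IndiscernibleLimitsContinuous L U := by
  intro hlim
  obtain ⟨a, b, ε, hε, ha, hconv, hlt⟩ := h
  have hex : ∀ p : phiTypes U φ, ∃ l : ℝ,
      Tendsto (fun i => ((p.1 (a i) : unitInterval) : ℝ)) atTop (𝓝 l) := by
    intro p
    obtain ⟨d, hd⟩ := hU.exists_realize_phiType hκ a p
    simp only [← hd]
    exact hconv d
  choose f hf using hex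
  have hcont := hlim k m φ a ha f hf
  have : CompactSpace (phiTypes U φ) := isCompact_iff_compactSpace.1 isClosed_closure.isCompact
  let 𝒰 : Ultrafilter ℕ := Filter.hyperfilter ℕ
  have h𝒰 : (𝒰 : Filter ℕ) ≤ atTop := Nat.hyperfilter_le_atTop
  obtain ⟨p, -, hp⟩ := (isCompact_univ (X := phiTypes U φ)).ultrafilter_le_nhds
    (𝒰.map fun j => realizedType φ (b j)) (by simp)
  have hp' : Tendsto (fun j => realizedType φ (b j)) 𝒰 (𝓝 p) := hp
  have hpa : ∀ i, Tendsto (fun j => φ.val₂ (b j) (a i)) 𝒰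
      (𝓝 ((p.1 (a i) : unitInterval) : ℝ)) := by
    intro i
    have h1 : Continuous fun q : phiTypes U φ => ((q.1 (a i) : unitInterval) : ℝ) :=
      continuous_subtype_val.comp ((continuous_apply (a i)).comp continuous_subtype_val)
    exact (h1.tendsto p).comp hp'
  have hle : ∀ i, ((p.1 (a i) : unitInterval) : ℝ) + ε ≤ f (realizedType φ (b i)) := by
    intro i
    refine le_of_tendsto_of_tendsto ((hpa i).add_const ε)
      ((hf (realizedType φ (b i))).mono_left h𝒰) ?_
    exact h𝒰 ((eventually_gt_atTop i).mono fun j hj => (hlt i j hj).le)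
  have := le_of_tendsto_of_tendsto' (((hf p).mono_left h𝒰).add_const ε)
    ((hcont.tendsto p).comp hp') hle
  linarith

/-- If the limit of the values along `(a_i)` jumps up near a pattern `x` of values, then the
formula has NSCP. -/
theorem formulaHasNSCP_of_jump {k m : ℕ} {φ : Formula L (Fin k ⊕ Fin m)} {a : ℕ → Fin m → U}
    (ha : IsIndiscernible L U a)
    (hconv : ∀ d : Fin k → U, ∃ l : ℝ, Tendsto (fun i => φ.val₂ d (a i)) atTop (𝓝 l))
    {x : ℕ → ℝ} {y : ℝ} (hx : Tendsto x atTop (𝓝 y)) {ε : ℝ} (hε : 0 < ε)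
    (hjump : ∀ N : ℕ, ∃ (d : Fin k → U) (l : ℝ), (∀ i < N, |φ.val₂ d (a i) - x i| < ε / 4) ∧
      Tendsto (fun i => φ.val₂ d (a i)) atTop (𝓝 l) ∧ y + ε ≤ l) :
    FormulaHasNSCP U φ := by
  choose d l hd hl hyl using hjump
  obtain ⟨I, hI⟩ := eventually_atTop.1 (hx.eventually_lt_const (show y < y + ε / 4 by linarith))
  have hT : ∀ N : ℕ, ∃ T : ℕ, ∀ n ≥ T, y + 3 * ε / 4 < φ.val₂ (d N) (a n) := fun N =>
    eventually_atTop.1 ((hl N).eventually_const_lt (by linarith [hyl N]))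
  choose T hT using hT
  -- Each index lies beyond the point where the previous tuple has become high. Then `φ(b_j, a_i) <
  -- y + ε / 2` and `φ(b_i, a_j) > y + 3ε / 4` for `i < j`, which leaves the gap `ε / 4`.
  let ν : ℕ → ℕ := fun i => Nat.rec I (fun _ n => max (n + 1) (T n)) i
  have hνs : ∀ i, ν (i + 1) = max (ν i + 1) (T (ν i)) := fun i => rfl
  have hν : StrictMono ν := strictMono_nat_of_lt_succ fun i => by
    rw [hνs]; exact Nat.lt_of_succ_le (le_max_left _ _)
  refine ⟨a ∘ ν, fun i => d (ν i), ε / 4, by linarith, fun n χ s t hs ht => ?_, fun d => ?_,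
    fun i j hij => ?_⟩
  · exact ha n χ (ν ∘ s) (ν ∘ t) (hν.comp hs) (hν.comp ht)
  · obtain ⟨l, hl⟩ := hconv d
    exact ⟨l, hl.comp hν.tendsto_atTop⟩
  · have h1 := (abs_lt.1 (hd (ν j) (ν i) (hν hij))).2
    have h2 := hI (ν i) (hν.monotone (Nat.zero_le i))
    have h3 : T (ν i) ≤ ν j := by
      refine le_trans ?_ (hν.monotone (Nat.succ_le_of_lt hij))
      rw [Nat.succ_eq_add_one, hνs]
      exact le_max_right _ _
    have h4 := hT (ν i) (ν j) h3
    simp only [Function.comp_apply]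
    linarith

/-- The formula `1 - φ`. -/
def Formula.neg {α : Type*} (φ : Formula L α) : Formula L α :=
  .conn (k := 1) ⟨fun t => unitInterval.symm (t 0), by fun_prop⟩ fun _ => φ

theorem val₂_neg {ι κ : Type} (φ : Formula L (ι ⊕ κ)) (d : ι → U) (a : κ → U) :
    φ.neg.val₂ d a = 1 - φ.val₂ d a := rfl

/-- Without NSCP, closeness to `p` at finitely many `a i` already controls the limit, and it defines
a neighbourhood of `p`. Jumps up are excluded by `φ`, jumps down by `1 - φ`. -/
theorem SCP.indiscernibleLimitsContinuous {κ : Cardinal.{w}}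
    (hκ : Cardinal.aleph0 < κ) (hU : IsSaturated L U κ) (h : SCP L U) :
    IndiscernibleLimitsContinuous L U := by
  intro k m φ a ha f hf
  have hconv : ∀ d : Fin k → U,
      Tendsto (fun i => φ.val₂ d (a i)) atTop (𝓝 (f (realizedType φ d))) :=
    fun d => hf (realizedType φ d)
  refine continuous_iff_continuousAt.2 fun p => Metric.tendsto_nhds.2 fun ε hε => ?_
  have hup : ∃ N : ℕ, ∀ (d : Fin k → U) (l : ℝ),
      (∀ i < N, |φ.val₂ d (a i) - p.1 (a i)| < ε / 4) →
      Tendsto (fun i => φ.val₂ d (a i)) atTop (𝓝 l) → l < f p + ε := by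
    by_contra! hcon
    exact h k m φ (formulaHasNSCP_of_jump ha (fun d => ⟨_, hconv d⟩) (hf p) hε hcon)
  have hdown : ∃ N : ℕ, ∀ (d : Fin k → U) (l : ℝ),
      (∀ i < N, |φ.val₂ d (a i) - p.1 (a i)| < ε / 4) →
      Tendsto (fun i => φ.val₂ d (a i)) atTop (𝓝 l) → f p - ε < l := by
    by_contra! hcon
    refine h k m φ.neg (formulaHasNSCP_of_jump (x := fun i => 1 - p.1 (a i)) (y := 1 - f p) ha
      (fun d => ⟨1 - f (realizedType φ d), (hconv d).const_sub 1⟩) ((hf p).const_sub 1) hε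
      fun N => ?_)
    obtain ⟨d, l, h1, h2, h3⟩ := hcon N
    refine ⟨d, 1 - l, fun i hi => ?_, h2.const_sub 1, by linarith⟩
    rw [val₂_neg, sub_sub_sub_cancel_left, abs_sub_comm]
    exact h1 i hi
  obtain ⟨N₁, hN₁⟩ := hup
  obtain ⟨N₂, hN₂⟩ := hdown
  have hev : ∀ᶠ q : phiTypes U φ in 𝓝 p, ∀ i ∈ Finset.range (max N₁ N₂),
      |((q.1 (a i) : unitInterval) : ℝ) - p.1 (a i)| < ε / 4 := by
    rw [Filter.eventually_all_finset]
    intro i _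
    have h1 : Continuous fun q : phiTypes U φ => ((q.1 (a i) : unitInterval) : ℝ) :=
      continuous_subtype_val.comp ((continuous_apply (a i)).comp continuous_subtype_val)
    exact Metric.tendsto_nhds.1 (h1.tendsto p) _ (by linarith)
  filter_upwards [hev] with q hq
  obtain ⟨d, hd⟩ := hU.exists_realize_phiType hκ a q
  have hd' : ∀ i, φ.val₂ d (a i) = q.1 (a i) := fun i => congrArg Subtype.val (hd i)
  have hl : Tendsto (fun i => φ.val₂ d (a i)) atTop (𝓝 (f q)) := by
    simp only [hd']
    exact hf q
  have h1 := hN₁ d _ (fun i hi => by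
    rw [hd']; exact hq i (Finset.mem_range.2 (hi.trans_le (le_max_left _ _)))) hl
  have h2 := hN₂ d _ (fun i hi => by
    rw [hd']; exact hq i (Finset.mem_range.2 (hi.trans_le (le_max_right _ _)))) hl
  rw [Real.dist_eq, abs_lt]
  constructor <;> linarith

end Limits

end ContLogic

theorem mainTheorem2 {L : ContLogic.ContLanguage.{u, v}} (T : ContLogic.Theory L)
    (U : Type w) [MetricSpace U] [ContLogic.ContStructure L U]
    (hU : ContLogic.IsMonsterModel T U) :
    List.TFAE [ContLogic.NwSOP L U, ContLogic.SCP L U,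
      ContLogic.IndiscernibleLimitsContinuous L U] := by
  obtain ⟨-, κ, hκ, hsat, -⟩ := hU
  tfae_have 1 → 2 := fun h k m φ hφ => h (hφ.hasWSOP hκ hsat)
  tfae_have 2 → 1 := fun h hw => by
    obtain ⟨k, m, φ, hφ⟩ := hw.exists_formulaHasNSCP
    exact h k m φ hφ
  tfae_have 2 → 3 := fun h => h.indiscernibleLimitsContinuous hκ hsat
  tfae_have 3 → 2 := fun h k m φ hφ => hφ.not_indiscernibleLimitsContinuous hκ hsat h
  tfae_finish
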